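/- Let $k\ge 1$ and $\beta\in(0,\infty)$. For a unital $C^*$-algebra $A$ let $S(A)$ be its state space with the weak-$*$ topology. Identify $M_k(\mathbb C)^{\otimes N}$ with the operators on $(\mathbb C^k)^{\otimes N}$, with the operator norm, let $S_N$ be the symmetrizer, $S_N(A_1\otimes\cdots\otimes A_N)=\frac1{N!}\sum_{\pi}A_{\pi(1)}\otimes\cdots\otimes A_{\pi(N)}$ (sum over all permutations of $\{1,\dots,N\}$), and for $M\le N$ put $S_{M,N}(a)=S_N(a\otimes I^{\otimes(N-M)})$. A sequence $(A_{1/N})_{N\ge1}$ with $A_{1/N}\in M_k(\mathbb C)^{\otimes N}$ is symmetric if for some $M\ge 1$ and $a\in M_k(\mathbb C)^{\otimes M}$ one has $A_{1/N}=S_{M,N}(a)$ for all $N\ge M$; it is quasi-symmetric if $A_{1/N}=S_N(A_{1/N})$ for all $N\ge1$ and for every $\varepsilon>0$ there are a symmetric sequence $(A'_{1/N})_N$ and an $M$ with $\|A_{1/N}-A'_{1/N}\|<\varepsilon$ for all $N>M$. The quasi-symmetric sequences are the continuous cross-sections of the mean-field bundle of $C^*$-algebras over $\{1/N : N\ge 1\}\cup\{0\}$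 with fibers $S_N(M_k(\mathbb C)^{\otimes N})$ at $1/N$ and $C(S(M_k(\mathbb C)))$ at $0$. Let $H=(H_{1/N})_{N\ge1}$ be such a continuous cross-section (a quasi-symmetric sequence) with every $H_{1/N}$ self-adjoint, and put $\tilde H_{1/N}=N H_{1/N}$. For a state $\omega$ of $M_k(\mathbb C)^{\otimes N}$ with density matrix $\rho^\omega$ (that is, $\omega(A)=\mathrm{Tr}(\rho^\omega A)$) let $F^\beta_{1/N}(\tilde H_{1/N},\omega)=\omega(\tilde H_{1/N})-\beta^{-1}S(\rho^\omega)$, where $S(\rho)=-\mathrm{Tr}(\rho\log\rho)$. Let $s_0(\rho)=S(\rho)$ for $\rho\in S(M_k(\mathbb C))$, identified with its density matrix; this is a continuous function. Then the following hold. 1. For every $\omega\in S(M_k(\mathbb C))$ the limit $h_0(\omega)=\lim_{N\to\infty}\omega^{\otimes N}(H_{1/N})$ exists, and $h_0$ is a continuous real-valued function on $S(M_k(\mathbb C))$. 2. For every $N\ge1$, the local free energy $F^\beta_{1/N}(\tilde H_{1/N}):=\inf_{\omega\in S(M_k(\mathbb C)^{\otimes N})}F^\beta_{1/N}(\tilde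 H_{1/N},\omega)$ equals $-\frac1\beta\log\mathrm{Tr}\,e^{-\beta\tilde H_{1/N}}$. 3. The free energy per site $\frac1N F^\beta_{1/N}(\tilde H_{1/N})=-\frac1{N\beta}\log\mathrm{Tr}\,e^{-\beta \tilde H_{1/N}}$ converges as $N\to\infty$ to a real number $F^\beta(\tilde H)$. With $F^\beta(\tilde H,\omega):=\omega(h_0)-\beta^{-1}\omega(s_0)$ for $\omega\in S(C(S(M_k(\mathbb C))))$ and $\delta_\rho(f):=f(\rho)$, $$F^\beta(\tilde H)=\inf_{\omega\in S(C(S(M_k(\mathbb C))))}F^\beta(\tilde H,\omega)=\inf_{\rho\in S(M_k(\mathbb C))}F^\beta(\tilde H,\delta_\rho)=\inf_{\rho\in S(M_k(\mathbb C))}\bigl(h_0(\rho)-\beta^{-1}S(\rho)\bigr).$$ -/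

import Mathlib

open Filter Topology
open scoped ComplexOrder

namespace MeanField

/-! ### States -/

/-- The state space `S(A)` of a unital C*-algebra `A`: positive functionals of value one at the
unit, with the weak-* topology. -/
def StateSpace (A : Type*) [Ring A] [StarRing A] [Algebra ℂ A] [TopologicalSpace A] :
    Set (WeakDual ℂ A) :=
  {φ | (∀ a : A, 0 ≤ φ (star a * a)) ∧ φ 1 = 1}

/-- The state `δ_x` on `C(X)` given by evaluation at the point `x`. -/
noncomputable def pointState {X : Type*} [TopologicalSpace X] (x : X) : StateSpace C(X, ℂ) :=
  ⟨StrongDual.toWeakDual (ContinuousMap.evalCLM ℂ x), by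
    refine ⟨fun a => ?_, ?_⟩
    · change 0 ≤ star (a x) * a x
      exact star_mul_self_nonneg (a x)
    · rfl⟩

theorem pointState_apply {X : Type*} [TopologicalSpace X] (x : X) (f : C(X, ℂ)) :
    (pointState x : WeakDual ℂ C(X, ℂ)) f = f x := rfl

/-! ### Density matrices and von Neumann entropy -/

section Density

variable {n : Type*} [Fintype n] [DecidableEq n]

/-- The density matrix `ρ^ω` of a functional `ω` on a matrix algebra: the matrix with
`ω(A) = Tr(ρ^ω A)` for all `A`. -/
noncomputable def densityMatrix (ω : WeakDual ℂ (Matrix n n ℂ)) : Matrix n n ℂ :=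
  Matrix.of fun i j => ω (Matrix.single j i 1)

/-- The von Neumann entropy `-Tr(ρ log ρ)`, where `-ρ log ρ` is obtained from the function
`x ↦ -x log x` (with `0 log 0 = 0`) by functional calculus. -/
noncomputable def vonNeumannEntropy (ρ : Matrix n n ℂ) : ℝ :=
  (cfc Real.negMulLog ρ).trace.re

theorem apply_eq_trace (ω : WeakDual ℂ (Matrix n n ℂ)) (A : Matrix n n ℂ) :
    ω A = (densityMatrix ω * A).trace := by
  conv_lhs => rw [Matrix.matrix_eq_sum_single A]
  rw [map_sum]
  simp only [map_sum, Matrix.trace, Matrix.diag, Matrix.mul_apply, densityMatrix, Matrix.of_apply]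
  rw [Finset.sum_comm]
  refine Finset.sum_congr rfl fun j _ => Finset.sum_congr rfl fun i _ => ?_
  have : Matrix.single i j (A i j) = A i j • Matrix.single i j (1 : ℂ) := by simp
  rw [this, map_smul, smul_eq_mul, mul_comm]

theorem densityMatrix_posSemidef {ω : WeakDual ℂ (Matrix n n ℂ)}
    (hω : ω ∈ StateSpace (Matrix n n ℂ)) : (densityMatrix ω).PosSemidef := by
  have key : ∀ x : n → ℂ, 0 ≤ star x ⬝ᵥ (densityMatrix ω).mulVec x := by
    intro x
    by_cases hn : Nonempty n
    · obtain ⟨i₀⟩ := hn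
      let B : Matrix n n ℂ := Matrix.of fun i j => if i = i₀ then star (x j) else 0
      have h := hω.1 B
      rw [apply_eq_trace] at h
      convert h using 1
      simp only [Matrix.trace, Matrix.diag, Matrix.mul_apply, dotProduct, Matrix.mulVec,
        Matrix.star_eq_conjTranspose, Matrix.conjTranspose_apply, B, Matrix.of_apply,
        Pi.star_apply, Finset.mul_sum]
      refine Finset.sum_congr rfl fun i _ => Finset.sum_congr rfl fun j _ => ?_
      rw [Finset.sum_eq_single i₀]
      · simp; ring
      · intro b _ hb; simp [hb]
      · simp
    · have := not_nonempty_iff.mp hn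
      simp [dotProduct]
  rw [← Matrix.isPositive_toEuclideanLin_iff, LinearMap.isPositive_iff_complex]
  intro x
  have h : inner ℂ (Matrix.toEuclideanLin (densityMatrix ω) x) x =
      star (star x.ofLp ⬝ᵥ (densityMatrix ω).mulVec x.ofLp) := by
    rw [EuclideanSpace.inner_eq_star_dotProduct, ← Matrix.star_dotProduct_star, star_star,
      dotProduct_comm]
    rfl
  have h0 := key x.ofLp
  rw [h, (IsSelfAdjoint.of_nonneg h0).star_eq]
  rw [Complex.le_def] at h0
  refine ⟨Complex.ext (by simp) (by simpa using h0.2), by simpa using h0.1⟩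

theorem densityMatrix_trace {ω : WeakDual ℂ (Matrix n n ℂ)}
    (hω : ω ∈ StateSpace (Matrix n n ℂ)) : (densityMatrix ω).trace = 1 := by
  rw [← hω.2, apply_eq_trace, mul_one]

open scoped Matrix.Norms.L2Operator in
theorem continuous_entropy :
    Continuous fun ω : StateSpace (Matrix n n ℂ) => vonNeumannEntropy (densityMatrix ω.1) := by
  have hd : Continuous fun ω : StateSpace (Matrix n n ℂ) => densityMatrix ω.1 := by
    refine continuous_matrix fun i j => ?_
    exact (WeakDual.eval_continuous (Matrix.single j i (1 : ℂ))).comp continuous_subtype_val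
  have hc : Continuous fun ω : StateSpace (Matrix n n ℂ) =>
      cfc Real.negMulLog (densityMatrix ω.1) := by
    refine Continuous.cfc' (s := Set.Icc (0 : ℝ) 1) isCompact_Icc Real.negMulLog hd
      ?_ Real.continuous_negMulLog.continuousOn
      (fun ω => (densityMatrix_posSemidef ω.2).1.isSelfAdjoint)
    intro ω
    have hp := densityMatrix_posSemidef ω.2
    have ht := densityMatrix_trace ω.2
    rw [hp.1.spectrum_real_eq_range_eigenvalues]
    rintro _ ⟨i, rfl⟩
    refine ⟨hp.eigenvalues_nonneg i, ?_⟩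
    have hs : ∑ j, hp.1.eigenvalues j = 1 := by
      rw [hp.1.trace_eq_sum_eigenvalues] at ht
      exact Complex.ofReal_injective (by simpa using ht)
    rw [← hs]
    exact Finset.single_le_sum (fun j _ => hp.eigenvalues_nonneg j) (Finset.mem_univ i)
  exact Complex.continuous_re.comp hc.matrix_trace

/-- The entropy function `s₀ ∈ C(S(M_k(ℂ)))`, `s₀(ω) = -Tr(ρ^ω log ρ^ω)`. -/
noncomputable def s₀ : C(StateSpace (Matrix n n ℂ), ℝ) :=
  ⟨fun ω => vonNeumannEntropy (densityMatrix ω.1), continuous_entropy⟩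

end Density

/-! ### Tensor powers of `M_k(ℂ)` -/

/-- The `N`-fold tensor power `M_k(ℂ)^{⊗N}`, realized as matrices on the product basis
`Fin N → Fin k` of `(ℂ^k)^{⊗N}`. -/
abbrev TensorPow (k N : ℕ) : Type := Matrix (Fin N → Fin k) (Fin N → Fin k) ℂ

variable {k : ℕ}

/-- The elementary tensor `A_1 ⊗ ⋯ ⊗ A_N`. -/
def elemTensor {N : ℕ} (A : Fin N → Matrix (Fin k) (Fin k) ℂ) : TensorPow k N :=
  Matrix.of fun f g => ∏ i, A i (f i) (g i)

/-- The symmetrizer `S_N`, the average over all permutations of the tensor factors. -/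
noncomputable def symmetrizer (N : ℕ) (A : TensorPow k N) : TensorPow k N :=
  ((N.factorial : ℂ)⁻¹) •
    ∑ π : Equiv.Perm (Fin N), Matrix.of fun f g => A (fun i => f (π i)) (fun i => g (π i))

/-- On elementary tensors, `S_N(A_1 ⊗ ⋯ ⊗ A_N) = (1/N!) ∑_π A_{π(1)} ⊗ ⋯ ⊗ A_{π(N)}`. -/
theorem symmetrizer_elemTensor {N : ℕ} (A : Fin N → Matrix (Fin k) (Fin k) ℂ) :
    symmetrizer N (elemTensor A) =
      ((N.factorial : ℂ)⁻¹) • ∑ π : Equiv.Perm (Fin N), elemTensor fun i => A (π i) := by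
  unfold symmetrizer
  congr 1
  refine Fintype.sum_equiv (Equiv.inv _) _ _ fun π => ?_
  ext f g
  simp only [elemTensor, Matrix.of_apply]
  exact Fintype.prod_equiv π _ _ fun i => by simp

/-- The embedding `A ↦ A ⊗ I ⊗ ⋯ ⊗ I` of `M_k(ℂ)^{⊗M}` into `M_k(ℂ)^{⊗N}` for `M ≤ N`. -/
def embed {M N : ℕ} (h : M ≤ N) (A : TensorPow k M) : TensorPow k N :=
  Matrix.of fun f g =>
    if ∀ i : Fin N, M ≤ i.1 → f i = g i then
      A (fun i => f (Fin.castLE h i)) (fun i => g (Fin.castLE h i))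
    else 0

/-- On elementary tensors, `embed` fills up with identity matrices. -/
theorem embed_elemTensor {M N : ℕ} (h : M ≤ N) (A : Fin M → Matrix (Fin k) (Fin k) ℂ) :
    embed h (elemTensor A) = elemTensor fun i : Fin N => if hi : i.1 < M then A ⟨i.1, hi⟩ else 1 := by
  obtain ⟨d, rfl⟩ := Nat.exists_eq_add_of_le h
  ext f g
  simp only [embed, elemTensor, Matrix.of_apply, Fin.prod_univ_add]
  have h1 : ∀ i : Fin M, Fin.castLE h i = Fin.castAdd d i := fun _ => rfl
  simp only [Fin.val_castAdd, Fin.is_lt, dite_true, Fin.eta, Fin.val_natAdd, h1]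
  have h2 : ∀ j : Fin d, (if hi : M + j.1 < M then A ⟨M + j.1, hi⟩ else 1) =
      (1 : Matrix (Fin k) (Fin k) ℂ) := fun j => dif_neg (by omega)
  simp only [h2]
  by_cases hfg : ∀ i : Fin (M + d), M ≤ i.1 → f i = g i
  · rw [if_pos hfg]
    refine ((congrArg _ (Finset.prod_eq_one fun j _ => ?_)).trans (mul_one _)).symm
    exact (congrArg _ (hfg (Fin.natAdd M j) (by simp)).symm).trans (Matrix.one_apply_eq _)
  · rw [if_neg hfg]
    push Not at hfg
    obtain ⟨i, hi, hne⟩ := hfg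
    refine (mul_eq_zero_of_right _ (Finset.prod_eq_zero
      (Finset.mem_univ (⟨i.1 - M, by omega⟩ : Fin d)) ?_)).symm
    have : Fin.natAdd M (⟨i.1 - M, by omega⟩ : Fin d) = i := Fin.ext (by simp; omega)
    rw [this]
    simp [hne]

/-- The linear functional `ω^N = ω ⊗ ⋯ ⊗ ω` on `M_k(ℂ)^{⊗N}`, written out on the matrix units. -/
noncomputable def productFunctional (ω : WeakDual ℂ (Matrix (Fin k) (Fin k) ℂ)) (N : ℕ) :
    TensorPow k N →ₗ[ℂ] ℂ where
  toFun A := ∑ f, ∑ g, A f g * ∏ i, ω (Matrix.single (f i) (g i) 1)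
  map_add' A B := by simp [add_mul, Finset.sum_add_distrib]
  map_smul' c A := by simp [mul_assoc, Finset.mul_sum]

/-- On elementary tensors, `ω^N(A_1 ⊗ ⋯ ⊗ A_N) = ω(A_1) ⋯ ω(A_N)`. -/
theorem productFunctional_elemTensor (ω : WeakDual ℂ (Matrix (Fin k) (Fin k) ℂ)) {N : ℕ}
    (A : Fin N → Matrix (Fin k) (Fin k) ℂ) :
    productFunctional ω N (elemTensor A) = ∏ i, ω (A i) := by
  have h : ∀ B : Matrix (Fin k) (Fin k) ℂ,
      ω B = ∑ p : Fin k × Fin k, B p.1 p.2 * ω (Matrix.single p.1 p.2 1) := by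
    intro B
    rw [Fintype.sum_prod_type]
    conv_lhs => rw [Matrix.matrix_eq_sum_single B]
    simp only [map_sum]
    refine Finset.sum_congr rfl fun i _ => Finset.sum_congr rfl fun j _ => ?_
    have : Matrix.single i j (B i j) = B i j • Matrix.single i j (1 : ℂ) := by simp
    rw [this, map_smul, smul_eq_mul]
  rw [Finset.prod_congr rfl fun i _ => h (A i), Finset.prod_univ_sum, Fintype.piFinset_univ]
  change ∑ f : Fin N → Fin k, ∑ g : Fin N → Fin k,
    elemTensor A f g * ∏ i, ω (Matrix.single (f i) (g i) 1) = _
  rw [← Fintype.sum_prod_type']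
  refine (Fintype.sum_equiv (Equiv.arrowProdEquivProdArrow (Fin N) (fun _ => Fin k) (fun _ => Fin k))
    _ _ fun p => ?_).symm
  rw [Finset.prod_mul_distrib]
  rfl

/-! ### Symmetric and quasi-symmetric sequences -/

/-- A sequence is symmetric if for some `M` and some `a ∈ M_k(ℂ)^{⊗M}` one has
`A_N = S_N(a ⊗ I ⊗ ⋯ ⊗ I)` for all `N ≥ M`. -/
def IsSymmetricSeq (A : ∀ N : ℕ, TensorPow k N) : Prop :=
  ∃ M : ℕ, 1 ≤ M ∧ ∃ a : TensorPow k M, ∀ (N : ℕ) (h : M ≤ N), A N = symmetrizer N (embed h a)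

open scoped Matrix.Norms.L2Operator in
/-- Quasi-symmetric (macroscopic) sequences, `N = 1, 2, …` (the entry at `N = 0` plays no role);
the norm is the operator norm. These are the continuous cross-sections (restricted to `1/N > 0`)
of the continuous bundle of C*-algebras over `{1/N} ∪ {0}` with fibers `S_N(M_k(ℂ)^{⊗N})` at `1/N`
and `C(S(M_k(ℂ)))` at `0`. -/
def IsQuasiSymmetric (A : ∀ N : ℕ, TensorPow k N) : Prop :=
  (∀ N : ℕ, 1 ≤ N → A N = symmetrizer N (A N)) ∧
    ∀ ε : ℝ, 0 < ε → ∃ A' : ∀ N : ℕ, TensorPow k N, IsSymmetricSeq A' ∧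
      ∃ M : ℕ, ∀ N : ℕ, M < N → ‖A N - A' N‖ < ε

/-! ### Free energies -/

/-- The local free energy `F_N^β(A, ω) = ω(A) - β⁻¹ S_N(ω)` of an observable `A` in the
state `ω` of `M_k(ℂ)^{⊗N}`. -/
noncomputable def localFreeEnergyAt {N : ℕ} (β : ℝ) (A : TensorPow k N)
    (ω : StateSpace (TensorPow k N)) : ℝ :=
  (ω.1 A).re - β⁻¹ * vonNeumannEntropy (densityMatrix ω.1)

/-- The local free energy `F_N^β(A) = -β⁻¹ log Tr e^{-βA}`. -/
noncomputable def localFreeEnergy {N : ℕ} (β : ℝ) (A : TensorPow k N) : ℝ :=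
  -(β⁻¹ * Real.log (NormedSpace.exp (-(β : ℂ) • A)).trace.re)

/-- The mean-field free energy `ω(h₀) - β⁻¹ ω(s₀)` in a state `ω` of `C(S(M_k(ℂ)))`. -/
noncomputable def meanFieldFreeEnergyAt (β : ℝ)
    (h₀ : C(StateSpace (Matrix (Fin k) (Fin k) ℂ), ℝ))
    (ω : StateSpace C(StateSpace (Matrix (Fin k) (Fin k) ℂ), ℂ)) : ℝ :=
  (ω.1 (h₀.realToRCLike ℂ)).re - β⁻¹ * (ω.1 (s₀.realToRCLike ℂ)).re

end MeanField

/-! Write `f = h₀ - β⁻¹ s₀` on the compact state space of `M_k(ℂ)`. The limit of the free energy per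
site is the minimum of `f`. Since `ω ↦ ω(f)` on states of the commutative algebra is bounded below
by `min f` (`le_state_apply`) and point evaluations attain it, the three infima coincide.

Upper bound (`freeEnergy_le_product`): insert the product state of a minimiser into the Gibbs
variational principle; entropy is additive on product states.

Lower bound (`eventually_le_freeEnergy`): the Gibbs state of `N H_N` is permutation invariant. Its
energy per site is that of a fixed few-body observable `a` up to `ε`. Its entropy is bounded above
by the Gibbs inequality `S(ω) ≤ log Tr e^B - ω(B)` with a trial `B` that sums copies of one `m`-body
`K` with `Tr e^K = 1` over disjoint blocks (`exists_blockSum`). What remains is the expectation of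
the single `m`-body observable `a + (β⁻¹/m) K`, and a quantum de Finetti argument
(`eventually_le_of_isPermInvariant`) bounds it below, for large `N`, by its infimum over product
states, minus `ε`.

For this, `K` must reproduce the entropy of every product state at once. By compactness, finitely
many normalised exponents `κ` suffice to approximate `S(ω)` by `-ω(κ)` (`exists_entropy_net`); `K`
is the logarithm of the uniform mixture of the product exponentials they generate
(`exists_mixture`). Operator monotonicity of the logarithm makes the loss a constant independent of
`m`, negligible per site. -/

namespace MeanField

/-! ### Functional calculus and traces in an eigenbasis. -/

section Spectral

variable {n : Type*} [Fintype n] [DecidableEq n]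

/-- The functional calculus of a unitarily diagonalized matrix. -/
theorem cfc_conj_diagonal {U : Matrix n n ℂ} (hU : U * star U = 1) (d : n → ℝ) (f : ℝ → ℝ) :
    cfc f (U * Matrix.diagonal (fun i => (d i : ℂ)) * star U) =
      U * Matrix.diagonal (fun i => (f (d i) : ℂ)) * star U := by
  set A := U * Matrix.diagonal (fun i => (d i : ℂ)) * star U with hA
  have hU' : star U * U = 1 := mul_eq_one_comm.mp hU
  have hAh : A.IsHermitian := by
    rw [hA, Matrix.star_eq_conjTranspose]
    refine Matrix.isHermitian_mul_mul_conjTranspose _ ?_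
    exact Matrix.isHermitian_diagonal_of_self_adjoint _ (by ext i; simp)
  -- Interpolating at both the given diagonal entries and the eigenvalues avoids having to identify
  -- the two sets; a polynomial then stands in for `f` on both sides.
  let s : Finset ℝ := Finset.univ.image d ∪ Finset.univ.image hAh.eigenvalues
  let p : Polynomial ℝ := Lagrange.interpolate s id f
  have hp : ∀ x ∈ s, p.eval x = f x := fun x hx =>
    Lagrange.eval_interpolate_at_node f Function.injective_id.injOn hx
  have hsa : IsSelfAdjoint A := hAh
  have hcfc : cfc f A = Polynomial.aeval A p := by
    rw [← cfc_polynomial p A hsa]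
    refine cfc_congr fun x hx => ?_
    rw [hAh.spectrum_real_eq_range_eigenvalues] at hx
    obtain ⟨i, rfl⟩ := hx
    exact (hp _ (by simp [s])).symm
  have hconj : ∀ q : Polynomial ℝ, Polynomial.aeval A q =
      U * Matrix.diagonal (fun i => ((q.eval (d i) : ℝ) : ℂ)) * star U := by
    intro q
    induction q using Polynomial.induction_on' with
    | add q₁ q₂ h₁ h₂ =>
      rw [map_add, h₁, h₂, ← add_mul, ← mul_add, Matrix.diagonal_add]
      simp
    | monomial m c =>
      have hpow : A ^ m = U * Matrix.diagonal (fun i => ((d i : ℂ)) ^ m) * star U := by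
        induction m with
        | zero => simp [hU]
        | succ m ih =>
          rw [pow_succ, ih, hA]
          calc _ = U * Matrix.diagonal (fun i => (d i : ℂ) ^ m) * (star U * U) *
                Matrix.diagonal (fun i => (d i : ℂ)) * star U := by simp only [mul_assoc]
            _ = _ := by rw [hU', mul_one, mul_assoc U, Matrix.diagonal_mul_diagonal]; simp [pow_succ]
      rw [Polynomial.aeval_monomial, hpow]
      have : (algebraMap ℝ (Matrix n n ℂ)) c = Matrix.diagonal fun _ => (c : ℂ) := by
        ext i j; simp [Matrix.algebraMap_matrix_apply, Matrix.diagonal_apply]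
      have hc : (Matrix.diagonal fun _ => (c : ℂ)) * U = U * Matrix.diagonal fun _ : n => (c : ℂ) := by
        ext i j; simp [mul_comm]
      rw [this, ← mul_assoc, ← mul_assoc, hc, mul_assoc U, Matrix.diagonal_mul_diagonal]
      simp
  rw [hcfc, hconj]
  congr 3
  funext i
  rw [hp _ (by simp [s])]

theorem trace_conj_diagonal {U : Matrix n n ℂ} (hU : U * star U = 1) (d : n → ℂ) :
    (U * Matrix.diagonal d * star U).trace = ∑ i, d i := by
  rw [Matrix.trace_mul_comm, ← mul_assoc, mul_eq_one_comm.mp hU, one_mul, Matrix.trace_diagonal]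

theorem IsHermitian.exists_conj_diagonal {A : Matrix n n ℂ} (hA : A.IsHermitian) :
    ∃ U : Matrix n n ℂ, U * star U = 1 ∧
      A = U * Matrix.diagonal (fun i => (hA.eigenvalues i : ℂ)) * star U := by
  refine ⟨hA.eigenvectorUnitary, Unitary.coe_mul_star_self _, ?_⟩
  conv_lhs => rw [hA.spectral_theorem]
  rw [Unitary.conjStarAlgAut_apply]
  rfl

theorem trace_cfc {A : Matrix n n ℂ} (hA : A.IsHermitian) (f : ℝ → ℝ) :
    (cfc f A).trace = ((∑ i, f (hA.eigenvalues i) : ℝ) : ℂ) := by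
  obtain ⟨U, hU, h⟩ := IsHermitian.exists_conj_diagonal hA
  have := congrArg (fun B => (cfc f B).trace) h
  rw [this, cfc_conj_diagonal hU, trace_conj_diagonal hU]
  simp

/-- Simultaneous spectral representation of `Tr f(A) g(B)`. -/
theorem exists_trace_cfc_mul_cfc {A B : Matrix n n ℂ} (hA : A.IsHermitian) (hB : B.IsHermitian) :
    ∃ w : n → n → ℝ, (∀ i j, 0 ≤ w i j) ∧ ∀ f g : ℝ → ℝ, (cfc f A * cfc g B).trace =
      ((∑ i, ∑ j, w i j * (f (hA.eigenvalues i) * g (hB.eigenvalues j)) : ℝ) : ℂ) := by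
  obtain ⟨U, hU, h⟩ := IsHermitian.exists_conj_diagonal hA
  obtain ⟨V, hV, h'⟩ := IsHermitian.exists_conj_diagonal hB
  -- The weights are the squared overlaps of the two eigenbases. They do not depend on `f` and `g`,
  -- so scalar inequalities transfer to traces.
  refine ⟨fun i j => Complex.normSq ((star U * V) i j), fun i j => Complex.normSq_nonneg _,
    fun f g => ?_⟩
  have h1 : cfc f A = _ := (congrArg (cfc f) h).trans (cfc_conj_diagonal hU _ f)
  have h2 : cfc g B = _ := (congrArg (cfc g) h').trans (cfc_conj_diagonal hV _ g)
  rw [h1, h2]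
  set D := Matrix.diagonal fun i => ((f (hA.eigenvalues i) : ℝ) : ℂ)
  set E := Matrix.diagonal fun i => ((g (hB.eigenvalues i) : ℝ) : ℂ)
  have : (U * D * star U * (V * E * star V)).trace =
      (D * (star U * V) * (E * star (star U * V))).trace := by
    rw [star_mul, star_star, show U * D * star U * (V * E * star V) =
      U * (D * star U * V * E * star V) by simp only [mul_assoc], Matrix.trace_mul_comm]
    simp only [mul_assoc]
  rw [this]
  simp only [Matrix.trace, Matrix.diag, Matrix.mul_apply (M := D * _), D, E, Matrix.diagonal_mul,
    Matrix.star_apply]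
  push_cast
  refine Finset.sum_congr rfl fun i _ => Finset.sum_congr rfl fun j _ => ?_
  rw [Complex.normSq_eq_conj_mul_self]
  simp
  ring

open scoped Matrix.Norms.L2Operator in
theorem cfc_real_exp {A : Matrix n n ℂ} (hA : A.IsHermitian) :
    cfc Real.exp A = NormedSpace.exp A :=
  CFC.real_exp_eq_normedSpace_exp (ha := hA)

theorem trace_exp {A : Matrix n n ℂ} (hA : A.IsHermitian) :
    (NormedSpace.exp A).trace = ((∑ i, Real.exp (hA.eigenvalues i) : ℝ) : ℂ) := by
  rw [← cfc_real_exp hA, trace_cfc hA]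

theorem trace_exp_pos [Nonempty n] {A : Matrix n n ℂ} (hA : A.IsHermitian) :
    0 < (NormedSpace.exp A).trace.re := by
  rw [trace_exp hA, Complex.ofReal_re]
  exact Finset.sum_pos (fun i _ => Real.exp_pos _) Finset.univ_nonempty

theorem trace_exp_eq_re {A : Matrix n n ℂ} (hA : A.IsHermitian) :
    (NormedSpace.exp A).trace = ((NormedSpace.exp A).trace.re : ℂ) := by
  rw [trace_exp hA, Complex.ofReal_re]

end Spectral

/-! ### States of matrix algebras and the Gibbs variational principle. -/

section States

variable {n : Type*} [Fintype n] [DecidableEq n]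

open scoped MatrixOrder Matrix.Norms.L2Operator in
theorem state_apply_nonneg {ω : WeakDual ℂ (Matrix n n ℂ)} (hω : ω ∈ StateSpace (Matrix n n ℂ))
    {A : Matrix n n ℂ} (hA : A.PosSemidef) : 0 ≤ ω A := by
  obtain ⟨B, rfl⟩ := CStarAlgebra.nonneg_iff_eq_star_mul_self.mp (Matrix.nonneg_iff_posSemidef.mpr hA)
  exact hω.1 B

theorem state_apply_conjTranspose {ω : WeakDual ℂ (Matrix n n ℂ)}
    (hω : ω ∈ StateSpace (Matrix n n ℂ)) (A : Matrix n n ℂ) :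
    ω A.conjTranspose = star (ω A) := by
  rw [apply_eq_trace, apply_eq_trace, ← Matrix.trace_conjTranspose, Matrix.conjTranspose_mul,
    (densityMatrix_posSemidef hω).1.eq, Matrix.trace_mul_comm]

theorem state_apply_eq_re {ω : WeakDual ℂ (Matrix n n ℂ)} (hω : ω ∈ StateSpace (Matrix n n ℂ))
    {A : Matrix n n ℂ} (hA : A.IsHermitian) : ω A = ((ω A).re : ℂ) := by
  have h := state_apply_conjTranspose hω A
  rw [hA.eq] at h
  exact (Complex.conj_eq_iff_re.mp h.symm).symm

open scoped MatrixOrder in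
theorem state_re_mono {ω : WeakDual ℂ (Matrix n n ℂ)} (hω : ω ∈ StateSpace (Matrix n n ℂ))
    {A B : Matrix n n ℂ} (h : A ≤ B) : (ω A).re ≤ (ω B).re := by
  have := state_apply_nonneg hω (Matrix.le_iff.mp h)
  rw [map_sub] at this
  have := (Complex.le_def.mp this).1
  simpa using this

open scoped MatrixOrder Matrix.Norms.L2Operator in
theorem abs_state_re_le {ω : WeakDual ℂ (Matrix n n ℂ)} (hω : ω ∈ StateSpace (Matrix n n ℂ))
    {A : Matrix n n ℂ} (hA : A.IsHermitian) : |(ω A).re| ≤ ‖A‖ := by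
  have hsa : IsSelfAdjoint A := hA
  have key : ∀ r : ℝ, (ω (algebraMap ℝ (Matrix n n ℂ) r)).re = r := by
    intro r
    have : algebraMap ℝ (Matrix n n ℂ) r = (r : ℂ) • 1 := by
      rw [Algebra.algebraMap_eq_smul_one]; ext i j; simp [Matrix.one_apply]
    rw [this, map_smul, hω.2]
    simp
  rw [abs_le]
  constructor
  · have := state_re_mono hω (hsa.neg_algebraMap_norm_le_self)
    rw [← map_neg, key] at this
    exact this
  · have := state_re_mono hω (hsa.le_algebraMap_norm_self)
    rwa [key] at this

/-- The functional `A ↦ Tr(ρ A)`. -/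
noncomputable def traceFunctional (ρ : Matrix n n ℂ) : WeakDual ℂ (Matrix n n ℂ) :=
  StrongDual.toWeakDual
    { toFun := fun A => (ρ * A).trace
      map_add' := fun A B => by rw [mul_add, Matrix.trace_add]
      map_smul' := fun c A => by simp
      cont := by fun_prop }

theorem traceFunctional_apply (ρ A : Matrix n n ℂ) : traceFunctional ρ A = (ρ * A).trace := rfl

theorem densityMatrix_traceFunctional (ρ : Matrix n n ℂ) :
    densityMatrix (traceFunctional ρ) = ρ := by
  ext i j
  simp [densityMatrix, traceFunctional_apply, Matrix.trace_mul_single]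

theorem traceFunctional_mem {ρ : Matrix n n ℂ} (hρ : ρ.PosSemidef) (htr : ρ.trace = 1) :
    traceFunctional ρ ∈ StateSpace (Matrix n n ℂ) := by
  refine ⟨fun A => ?_, by rw [traceFunctional_apply, mul_one, htr]⟩
  rw [traceFunctional_apply, Matrix.star_eq_conjTranspose, ← mul_assoc, Matrix.trace_mul_comm,
    ← mul_assoc]
  exact (hρ.mul_mul_conjTranspose_same A).trace_nonneg

/-- The Gibbs variational principle, inequality part. -/
theorem re_add_entropy_le_log_trace_exp [Nonempty n] {ω : WeakDual ℂ (Matrix n n ℂ)}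
    (hω : ω ∈ StateSpace (Matrix n n ℂ)) {K : Matrix n n ℂ} (hK : K.IsHermitian) :
    (ω K).re + vonNeumannEntropy (densityMatrix ω) ≤
      Real.log (NormedSpace.exp K).trace.re := by
  set ρ := densityMatrix ω
  have hρ : ρ.PosSemidef := densityMatrix_posSemidef hω
  obtain ⟨w, hw, h⟩ := exists_trace_cfc_mul_cfc hρ.1 hK
  have hsρ : IsSelfAdjoint ρ := hρ.1
  have hsK : IsSelfAdjoint K := hK
  have hZ := trace_exp_pos hK
  set Z := (NormedSpace.exp K).trace.re
  -- Energy, entropy, partition function and normalisation are all written with the same weights;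
  -- the factors `1` come from the constant function in one slot.
  have h1 : (ω K).re = ∑ i, ∑ j, w i j * (hρ.1.eigenvalues i * hK.eigenvalues j) := by
    have := h id id
    rw [cfc_id ℝ ρ hsρ, cfc_id ℝ K hsK] at this
    rw [apply_eq_trace, this]; rfl
  have h2 : vonNeumannEntropy ρ = ∑ i, ∑ j, w i j * (Real.negMulLog (hρ.1.eigenvalues i) * 1) := by
    have := h Real.negMulLog (fun _ => 1)
    rw [cfc_const_one ℝ K hsK, mul_one] at this
    rw [vonNeumannEntropy, this]; rfl
  have h3 : Z = ∑ i, ∑ j, w i j * (1 * Real.exp (hK.eigenvalues j)) := by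
    have := h (fun _ => 1) Real.exp
    rw [cfc_const_one ℝ ρ hsρ, one_mul, cfc_real_exp hK] at this
    simp only [Z, this]; rfl
  have h4 : 1 = ∑ i, ∑ j, w i j * (hρ.1.eigenvalues i * 1) := by
    have := h id (fun _ => 1)
    rw [cfc_const_one ℝ K hsK, mul_one, cfc_id ℝ ρ hsρ, densityMatrix_trace hω] at this
    exact_mod_cast this
  -- This is `log u ≤ u - 1` at `u = e^κ / (Z x)`, multiplied by `x`. After averaging with `w`, the
  -- right-hand side becomes `Z⁻¹ Z - 1 = 0`.
  have key : ∀ x κ : ℝ, 0 ≤ x →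
      x * κ + Real.negMulLog x * 1 - Real.log Z * (x * 1) ≤ Z⁻¹ * (1 * Real.exp κ) - x * 1 := by
    intro x κ hx
    rcases hx.eq_or_lt with rfl | hx
    · simp; positivity
    have hlog := Real.log_le_sub_one_of_pos (x := Real.exp κ / (Z * x)) (by positivity)
    rw [Real.log_div (by positivity) (by positivity), Real.log_exp,
      Real.log_mul hZ.ne' hx.ne'] at hlog
    have := mul_le_mul_of_nonneg_left hlog hx.le
    have e : x * (Real.exp κ / (Z * x) - 1) = Z⁻¹ * Real.exp κ - x := by field_simp
    rw [e] at this
    unfold Real.negMulLog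
    linarith
  have hsum : ∑ i, ∑ j, w i j * (hρ.1.eigenvalues i * hK.eigenvalues j +
        Real.negMulLog (hρ.1.eigenvalues i) * 1 - Real.log Z * (hρ.1.eigenvalues i * 1)) ≤
      ∑ i, ∑ j, w i j * (Z⁻¹ * (1 * Real.exp (hK.eigenvalues j)) - hρ.1.eigenvalues i * 1) :=
    Finset.sum_le_sum fun i _ => Finset.sum_le_sum fun j _ =>
      mul_le_mul_of_nonneg_left (key _ _ (hρ.eigenvalues_nonneg i)) (hw i j)
  have e1 : ∀ i j, w i j * (Real.log Z * (hρ.1.eigenvalues i * 1)) =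
      Real.log Z * (w i j * (hρ.1.eigenvalues i * 1)) := fun _ _ => by ring
  have e2 : ∀ i j, w i j * (Z⁻¹ * (1 * Real.exp (hK.eigenvalues j))) =
      Z⁻¹ * (w i j * (1 * Real.exp (hK.eigenvalues j))) := fun _ _ => by ring
  simp only [mul_sub, mul_add, Finset.sum_sub_distrib, Finset.sum_add_distrib, e1, e2,
    ← Finset.mul_sum] at hsum
  rw [← h1, ← h2, ← h3, ← h4, inv_mul_cancel₀ hZ.ne'] at hsum
  linarith

/-- The density matrix `e^K / Tr e^K`. -/
noncomputable def gibbsDensity (K : Matrix n n ℂ) : Matrix n n ℂ :=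
  ((NormedSpace.exp K).trace)⁻¹ • NormedSpace.exp K

theorem gibbsDensity_eq_cfc {K : Matrix n n ℂ} (hK : K.IsHermitian) :
    gibbsDensity K =
      cfc (fun x => ((NormedSpace.exp K).trace.re)⁻¹ * Real.exp x) K := by
  have hsK : IsSelfAdjoint K := hK
  rw [gibbsDensity, cfc_const_mul _ _ K, cfc_real_exp hK, trace_exp_eq_re hK]
  ext i j
  simp

open scoped MatrixOrder in
theorem gibbsDensity_mem [Nonempty n] {K : Matrix n n ℂ} (hK : K.IsHermitian) :
    traceFunctional (gibbsDensity K) ∈ StateSpace (Matrix n n ℂ) := by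
  have hZ := trace_exp_pos hK
  refine traceFunctional_mem ?_ ?_
  · rw [gibbsDensity_eq_cfc hK]
    exact Matrix.nonneg_iff_posSemidef.mp (cfc_nonneg fun x _ => by positivity)
  · rw [gibbsDensity, Matrix.trace_smul, smul_eq_mul, inv_mul_cancel₀]
    rw [trace_exp_eq_re hK]
    exact_mod_cast hZ.ne'

/-- The Gibbs variational principle, equality in the Gibbs state. -/
theorem gibbs_re_add_entropy [Nonempty n] {K : Matrix n n ℂ} (hK : K.IsHermitian) :
    (traceFunctional (gibbsDensity K) K).re + vonNeumannEntropy (gibbsDensity K) =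
      Real.log (NormedSpace.exp K).trace.re := by
  have hZ := trace_exp_pos hK
  have hsK : IsSelfAdjoint K := hK
  have htr := (gibbsDensity_mem hK).2
  rw [traceFunctional_apply, mul_one] at htr
  rw [traceFunctional_apply, vonNeumannEntropy]
  rw [gibbsDensity_eq_cfc hK] at htr ⊢
  set Z := (NormedSpace.exp K).trace.re
  rw [← cfc_comp' Real.negMulLog _ K (Real.continuous_negMulLog.continuousOn)]
  conv_lhs => enter [1, 1, 1, 2]; rw [← cfc_id ℝ K hsK]
  rw [← cfc_mul _ _ K, trace_cfc hK, trace_cfc hK, Complex.ofReal_re, Complex.ofReal_re,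
    ← Finset.sum_add_distrib]
  rw [trace_cfc hK] at htr
  have htr' : ∑ i, Z⁻¹ * Real.exp (hK.eigenvalues i) = 1 := by exact_mod_cast htr
  -- With `p = e^κ / Z` the claim is now termwise: `p κ - p log p = p log Z`.
  rw [← mul_one (Real.log Z), ← htr', Finset.mul_sum]
  refine Finset.sum_congr rfl fun i _ => ?_
  rw [Real.negMulLog, Real.log_mul (by positivity) (by positivity), Real.log_exp, Real.log_inv]
  simp only [id]
  ring

end States

variable {k : ℕ}

/-! ### Algebra of elementary tensors. -/

section ElementaryTensors

theorem elemTensor_mul {N : ℕ} (A B : Fin N → Matrix (Fin k) (Fin k) ℂ) :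
    elemTensor A * elemTensor B = elemTensor fun i => A i * B i := by
  ext f g
  simp only [elemTensor, Matrix.mul_apply, Matrix.of_apply]
  rw [Finset.prod_univ_sum, Fintype.piFinset_univ]
  exact Finset.sum_congr rfl fun h _ => Finset.prod_mul_distrib.symm

theorem star_elemTensor {N : ℕ} (A : Fin N → Matrix (Fin k) (Fin k) ℂ) :
    star (elemTensor A) = elemTensor fun i => star (A i) := by
  ext f g
  simp [elemTensor, Matrix.star_apply]

theorem elemTensor_diagonal {N : ℕ} (d : Fin N → Fin k → ℂ) :
    elemTensor (fun i => Matrix.diagonal (d i)) =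
      Matrix.diagonal fun f : Fin N → Fin k => ∏ i, d i (f i) := by
  ext f g
  simp only [elemTensor, Matrix.of_apply]
  by_cases h : f = g
  · subst h; simp
  · rw [Matrix.diagonal_apply_ne _ h]
    obtain ⟨i, hi⟩ := Function.ne_iff.mp h
    exact Finset.prod_eq_zero (Finset.mem_univ i) (Matrix.diagonal_apply_ne _ hi)

theorem elemTensor_one {N : ℕ} :
    elemTensor (fun _ : Fin N => (1 : Matrix (Fin k) (Fin k) ℂ)) = 1 := by
  simp only [← Matrix.diagonal_one, elemTensor_diagonal, Finset.prod_const_one]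

open scoped MatrixOrder Matrix.Norms.L2Operator in
theorem elemTensor_posSemidef {N : ℕ} {A : Fin N → Matrix (Fin k) (Fin k) ℂ}
    (hA : ∀ i, (A i).PosSemidef) : (elemTensor A).PosSemidef := by
  choose B hB using fun i =>
    CStarAlgebra.nonneg_iff_eq_star_mul_self.mp (Matrix.nonneg_iff_posSemidef.mpr (hA i))
  have : elemTensor A = star (elemTensor B) * elemTensor B := by
    rw [star_elemTensor, elemTensor_mul]
    exact congrArg _ (funext hB)
  rw [this]
  exact Matrix.posSemidef_conjTranspose_mul_self _

theorem trace_elemTensor {N : ℕ} (A : Fin N → Matrix (Fin k) (Fin k) ℂ) :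
    (elemTensor A).trace = ∏ i, (A i).trace := by
  simp only [Matrix.trace, Matrix.diag, elemTensor, Matrix.of_apply]
  rw [Finset.prod_univ_sum, Fintype.piFinset_univ]

theorem elemTensor_update {N : ℕ} (A : Fin N → Matrix (Fin k) (Fin k) ℂ) (i : Fin N)
    (X : Matrix (Fin k) (Fin k) ℂ) (f g : Fin N → Fin k) :
    elemTensor (Function.update A i X) f g =
      X (f i) (g i) * ∏ j ∈ Finset.univ.erase i, A j (f j) (g j) := by
  simp only [elemTensor, Matrix.of_apply]
  rw [← Finset.mul_prod_erase _ _ (Finset.mem_univ i)]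
  congr 1
  · simp
  · refine Finset.prod_congr rfl fun j hj => ?_
    rw [Function.update_of_ne (Finset.ne_of_mem_erase hj)]

theorem elemTensor_update_add {N : ℕ} (A : Fin N → Matrix (Fin k) (Fin k) ℂ) (i : Fin N)
    (X Y : Matrix (Fin k) (Fin k) ℂ) :
    elemTensor (Function.update A i (X + Y)) =
      elemTensor (Function.update A i X) + elemTensor (Function.update A i Y) := by
  ext f g
  simp only [Matrix.add_apply, elemTensor_update, add_mul]

theorem elemTensor_update_smul {N : ℕ} (A : Fin N → Matrix (Fin k) (Fin k) ℂ) (i : Fin N)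
    (c : ℂ) (X : Matrix (Fin k) (Fin k) ℂ) :
    elemTensor (Function.update A i (c • X)) = c • elemTensor (Function.update A i X) := by
  ext f g
  simp only [Matrix.smul_apply, elemTensor_update, smul_eq_mul, mul_assoc]

theorem single_eq_elemTensor {N : ℕ} (f g : Fin N → Fin k) :
    (Matrix.single f g 1 : TensorPow k N) = elemTensor fun i => Matrix.single (f i) (g i) 1 := by
  ext f' g'
  simp only [elemTensor, Matrix.of_apply, Matrix.single_apply]
  by_cases h : f = f' ∧ g = g'
  · obtain ⟨rfl, rfl⟩ := h
    simp
  · rw [if_neg h]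
    have : ∃ i, ¬(f i = f' i ∧ g i = g' i) := by
      by_contra! hc
      exact h ⟨funext fun i => (hc i).1, funext fun i => (hc i).2⟩
    obtain ⟨i, hi⟩ := this
    exact (Finset.prod_eq_zero (Finset.mem_univ i) (if_neg hi)).symm

theorem eq_sum_elemTensor {N : ℕ} (A : TensorPow k N) :
    A = ∑ f, ∑ g, A f g • elemTensor fun i => Matrix.single (f i) (g i) (1 : ℂ) := by
  conv_lhs => rw [Matrix.matrix_eq_sum_single A]
  refine Finset.sum_congr rfl fun f _ => Finset.sum_congr rfl fun g _ => ?_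
  rw [← single_eq_elemTensor, Matrix.smul_single, smul_eq_mul, mul_one]

/-- Matrix units are elementary tensors, so the latter span. This reduces identities between
embeddings, permutations and product functionals to a factor-by-factor check. -/
theorem ext_elemTensor {N : ℕ} {V : Type*} [AddCommMonoid V] [Module ℂ V]
    {φ ψ : TensorPow k N →ₗ[ℂ] V} (h : ∀ A, φ (elemTensor A) = ψ (elemTensor A)) : φ = ψ := by
  ext1 A
  rw [eq_sum_elemTensor A]
  simp only [map_sum, map_smul, h]

end ElementaryTensors

/-! ### Embeddings, permutations and the symmetrizer as linear maps. -/

section Linear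

/-- `embed` as a linear map. -/
def embedₗ {M N : ℕ} (h : M ≤ N) : TensorPow k M →ₗ[ℂ] TensorPow k N where
  toFun := embed h
  map_add' A B := by
    ext f g; simp only [embed, Matrix.of_apply, Matrix.add_apply]; split_ifs <;> simp
  map_smul' c A := by
    ext f g; simp only [embed, Matrix.of_apply, Matrix.smul_apply, RingHom.id_apply]
    split_ifs <;> simp

theorem embedₗ_apply {M N : ℕ} (h : M ≤ N) (A : TensorPow k M) : embedₗ h A = embed h A := rfl

theorem embed_trans {L M N : ℕ} (h : L ≤ M) (h' : M ≤ N) (A : TensorPow k L) :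
    embed h' (embed h A) = embed (h.trans h') A := by
  have : (embedₗ h').comp (embedₗ h) = (embedₗ (h.trans h') : TensorPow k L →ₗ[ℂ] _) := by
    refine ext_elemTensor fun A => ?_
    simp only [LinearMap.comp_apply, embedₗ_apply, embed_elemTensor]
    congr 1
    funext i
    by_cases h1 : i.1 < L
    · simp [h1, h1.trans_le h]
    · simp [h1]
  exact LinearMap.congr_fun this A

theorem embed_isHermitian {M N : ℕ} (h : M ≤ N) {A : TensorPow k M} (hA : A.IsHermitian) :
    (embed h A).IsHermitian := by
  ext f g
  simp only [embed, Matrix.conjTranspose_apply, Matrix.of_apply]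
  have : (∀ i : Fin N, M ≤ i.1 → g i = f i) ↔ ∀ i : Fin N, M ≤ i.1 → f i = g i :=
    ⟨fun h i hi => (h i hi).symm, fun h i hi => (h i hi).symm⟩
  simp only [this]
  split_ifs
  · exact hA.apply _ _
  · simp

/-- The automorphism of `M_k(ℂ)^{⊗N}` permuting the tensor factors. -/
def permute {N : ℕ} (π : Equiv.Perm (Fin N)) : TensorPow k N →ₗ[ℂ] TensorPow k N where
  toFun A := Matrix.of fun f g => A (fun i => f (π i)) (fun i => g (π i))
  map_add' _ _ := rfl
  map_smul' _ _ := rfl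

theorem permute_eq_reindex {N : ℕ} (π : Equiv.Perm (Fin N)) (A : TensorPow k N) :
    permute π A = Matrix.reindexAlgEquiv ℂ ℂ (Equiv.arrowCongr π (Equiv.refl (Fin k))) A := by
  ext f g
  rfl

theorem permute_elemTensor {N : ℕ} (π : Equiv.Perm (Fin N))
    (A : Fin N → Matrix (Fin k) (Fin k) ℂ) :
    permute π (elemTensor A) = elemTensor fun i => A (π.symm i) := by
  ext f g
  exact Fintype.prod_equiv π _ _ fun i => by simp

theorem permute_permute {N : ℕ} (π σ : Equiv.Perm (Fin N)) (A : TensorPow k N) :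
    permute π (permute σ A) = permute (π * σ) A := rfl

theorem symmetrizer_eq_sum_permute {N : ℕ} (A : TensorPow k N) :
    symmetrizer N A = ((N.factorial : ℂ)⁻¹) • ∑ π : Equiv.Perm (Fin N), permute π A := rfl

theorem permute_symmetrizer {N : ℕ} (π : Equiv.Perm (Fin N)) (A : TensorPow k N) :
    permute π (symmetrizer N A) = symmetrizer N A := by
  simp only [symmetrizer_eq_sum_permute, map_smul, map_sum, permute_permute]
  congr 1
  exact Fintype.sum_equiv (Equiv.mulLeft π) _ _ fun σ => rfl

/-- Permutation invariant functionals. -/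
def IsPermInvariant {N : ℕ} (φ : TensorPow k N →ₗ[ℂ] ℂ) : Prop :=
  ∀ (π : Equiv.Perm (Fin N)) (A : TensorPow k N), φ (permute π A) = φ A

theorem IsPermInvariant.symmetrizer {N : ℕ} {φ : TensorPow k N →ₗ[ℂ] ℂ} (h : IsPermInvariant φ)
    (A : TensorPow k N) : φ (symmetrizer N A) = φ A := by
  rw [symmetrizer_eq_sum_permute, map_smul, map_sum, Finset.sum_congr rfl fun π _ => h π A]
  simp only [Finset.sum_const, Finset.card_univ, Fintype.card_perm, Fintype.card_fin,
    nsmul_eq_mul, smul_eq_mul]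
  rw [inv_mul_cancel_left₀]
  exact_mod_cast N.factorial_ne_zero

theorem permute_isHermitian {N : ℕ} (π : Equiv.Perm (Fin N)) {A : TensorPow k N}
    (hA : A.IsHermitian) : (permute π A).IsHermitian := by
  ext f g
  exact hA.apply _ _

theorem symmetrizer_isHermitian {N : ℕ} {A : TensorPow k N} (hA : A.IsHermitian) :
    (symmetrizer N A).IsHermitian := by
  rw [symmetrizer_eq_sum_permute, Matrix.IsHermitian, Matrix.conjTranspose_smul,
    Matrix.conjTranspose_sum]
  simp only [(permute_isHermitian _ hA).eq]
  simp

end Linear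

/-! ### Product states and additivity of the entropy. -/

section ProductStates

theorem productFunctional_isPermInvariant (ω : WeakDual ℂ (Matrix (Fin k) (Fin k) ℂ)) (N : ℕ) :
    IsPermInvariant (productFunctional ω N) := by
  intro π A
  have : (productFunctional ω N).comp (permute π) = productFunctional ω N := by
    refine ext_elemTensor fun A => ?_
    rw [LinearMap.comp_apply, permute_elemTensor, productFunctional_elemTensor,
      productFunctional_elemTensor]
    exact Fintype.prod_equiv π.symm _ _ fun i => rfl
  exact LinearMap.congr_fun this A

theorem productFunctional_embed {ω : WeakDual ℂ (Matrix (Fin k) (Fin k) ℂ)} (hω : ω 1 = 1)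
    {M N : ℕ} (h : M ≤ N) (A : TensorPow k M) :
    productFunctional ω N (embed h A) = productFunctional ω M A := by
  have : (productFunctional ω N).comp (embedₗ h) = productFunctional ω M := by
    refine ext_elemTensor fun A => ?_
    rw [LinearMap.comp_apply, embedₗ_apply, embed_elemTensor, productFunctional_elemTensor,
      productFunctional_elemTensor]
    obtain ⟨d, rfl⟩ := Nat.exists_eq_add_of_le h
    rw [Fin.prod_univ_add]
    simp [hω]
  exact LinearMap.congr_fun this A

/-- Positivity of the product functional is not visible from its expansion in matrix units; it
follows from the density matrix `ρ^{⊗N}`. -/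
theorem productFunctional_eq_trace (ω : WeakDual ℂ (Matrix (Fin k) (Fin k) ℂ)) (N : ℕ)
    (A : TensorPow k N) :
    productFunctional ω N A = traceFunctional (elemTensor fun _ => densityMatrix ω) A := by
  have : productFunctional ω N =
      (traceFunctional (elemTensor fun _ : Fin N => densityMatrix ω)).toLinearMap := by
    refine ext_elemTensor fun A => ?_
    rw [productFunctional_elemTensor]
    change _ = ((elemTensor fun _ => densityMatrix ω) * elemTensor A).trace
    rw [elemTensor_mul, trace_elemTensor]
    exact Finset.prod_congr rfl fun i _ => apply_eq_trace ω _
  exact LinearMap.congr_fun this A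

/-- The product state `ω^{⊗N}`. -/
noncomputable def productState (ω : StateSpace (Matrix (Fin k) (Fin k) ℂ)) (N : ℕ) :
    StateSpace (TensorPow k N) :=
  ⟨traceFunctional (elemTensor fun _ => densityMatrix ω.1),
    traceFunctional_mem (elemTensor_posSemidef fun _ => densityMatrix_posSemidef ω.2) (by
      rw [trace_elemTensor]
      simp [densityMatrix_trace ω.2])⟩

theorem productState_apply (ω : StateSpace (Matrix (Fin k) (Fin k) ℂ)) {N : ℕ}
    (A : TensorPow k N) : (productState ω N).1 A = productFunctional ω.1 N A :=
  (productFunctional_eq_trace ω.1 N A).symm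

/-- `Real.negMulLog` obeys a product rule, and the weights of the other coordinates sum to one, so
each coordinate contributes the same amount. -/
theorem sum_negMulLog_prod {ι : Type*} [Fintype ι] {d : ι → ℝ} (hd : ∑ i, d i = 1) (N : ℕ) :
    ∑ f : Fin N → ι, Real.negMulLog (∏ i, d (f i)) = N * ∑ i, Real.negMulLog (d i) := by
  induction N with
  | zero => simp
  | succ N ih =>
    rw [← (Fin.consEquiv fun _ => ι).sum_comp, Fintype.sum_prod_type]
    have : ∀ (a : ι) (f : Fin N → ι),
        Real.negMulLog (∏ i, d ((Fin.consEquiv fun _ => ι) (a, f) i)) =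
          (∏ i, d (f i)) * Real.negMulLog (d a) + d a * Real.negMulLog (∏ i, d (f i)) := by
      intro a f
      rw [← Real.negMulLog_mul, Fin.prod_univ_succ]
      rfl
    have hprod : ∑ f : Fin N → ι, ∏ i, d (f i) = 1 := by
      have := Finset.prod_univ_sum (fun _ : Fin N => Finset.univ) (fun _ => d)
      rw [Fintype.piFinset_univ] at this
      rw [← this]
      simp [hd]
    simp only [this, Finset.sum_add_distrib, ← Finset.sum_mul, ← Finset.mul_sum, hprod, hd, ih]
    push_cast
    ring

/-- Additivity of the entropy on product states. -/
theorem entropy_productState (ω : StateSpace (Matrix (Fin k) (Fin k) ℂ)) (N : ℕ) :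
    vonNeumannEntropy (densityMatrix (productState ω N).1) =
      N * vonNeumannEntropy (densityMatrix ω.1) := by
  have hρ := densityMatrix_posSemidef ω.2
  have htr := densityMatrix_trace ω.2
  change vonNeumannEntropy (densityMatrix (traceFunctional (elemTensor _))) = _
  rw [densityMatrix_traceFunctional]
  set ρ := densityMatrix ω.1
  obtain ⟨U, hU, h⟩ := IsHermitian.exists_conj_diagonal hρ.1
  set d := hρ.1.eigenvalues
  have hd : ∑ i, d i = 1 := by
    rw [hρ.1.trace_eq_sum_eigenvalues] at htr
    exact Complex.ofReal_injective (by simpa using htr)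
  -- `U^{⊗N}` diagonalises `ρ^{⊗N}`, with products of eigenvalues of `ρ` on the diagonal.
  have hW : elemTensor (fun _ : Fin N => U) * star (elemTensor fun _ : Fin N => U) = 1 := by
    rw [star_elemTensor, elemTensor_mul]
    simp only [hU]
    exact elemTensor_one
  have hT : (elemTensor fun _ : Fin N => ρ) = elemTensor (fun _ : Fin N => U) *
      Matrix.diagonal (fun f : Fin N → Fin k => ((∏ i, d (f i) : ℝ) : ℂ)) *
        star (elemTensor fun _ : Fin N => U) := by
    have e : Matrix.diagonal (fun f : Fin N → Fin k => ((∏ i, d (f i) : ℝ) : ℂ)) =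
        elemTensor fun _ : Fin N => Matrix.diagonal fun i => (d i : ℂ) := by
      rw [elemTensor_diagonal]
      push_cast
      rfl
    rw [e, star_elemTensor, elemTensor_mul, elemTensor_mul]
    exact congrArg elemTensor (funext fun _ => h)
  rw [vonNeumannEntropy, vonNeumannEntropy, trace_cfc hρ.1, hT, cfc_conj_diagonal hW,
    trace_conj_diagonal hW]
  rw [← Complex.ofReal_sum, Complex.ofReal_re, Complex.ofReal_re, sum_negMulLog_prod hd]

end ProductStates

/-! ### Sums of commuting copies of an observable over disjoint blocks. -/

section BlockSums

open scoped Kronecker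

/-- The embedding `A ↦ A ⊗ 1` of `M_k(ℂ)^{⊗M}` into `M_k(ℂ)^{⊗(M+N)}`. -/
def tensorLeft (M N : ℕ) : TensorPow k M →ₐ[ℂ] TensorPow k (M + N) :=
  (Matrix.reindexAlgEquiv ℂ ℂ (Fin.appendEquiv M N)).toAlgHom.comp
    (AlgHom.ofLinearMap
      { toFun := fun A => A ⊗ₖ (1 : TensorPow k N)
        map_add' := fun A B => Matrix.add_kronecker A B _
        map_smul' := fun c A => Matrix.smul_kronecker c A _ }
      Matrix.one_kronecker_one
      fun A B => by
        change (A * B) ⊗ₖ (1 : TensorPow k N) = _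
        conv_lhs => rw [← mul_one (1 : TensorPow k N)]
        exact Matrix.mul_kronecker_mul _ _ _ _)

/-- The embedding `B ↦ 1 ⊗ B` of `M_k(ℂ)^{⊗N}` into `M_k(ℂ)^{⊗(M+N)}`. -/
def tensorRight (M N : ℕ) : TensorPow k N →ₐ[ℂ] TensorPow k (M + N) :=
  (Matrix.reindexAlgEquiv ℂ ℂ (Fin.appendEquiv M N)).toAlgHom.comp
    (AlgHom.ofLinearMap
      { toFun := fun B => (1 : TensorPow k M) ⊗ₖ B
        map_add' := fun A B => Matrix.kronecker_add _ A B
        map_smul' := fun c A => Matrix.kronecker_smul c _ A }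
      Matrix.one_kronecker_one
      fun A B => by
        change (1 : TensorPow k M) ⊗ₖ (A * B) = _
        conv_lhs => rw [← mul_one (1 : TensorPow k M)]
        exact Matrix.mul_kronecker_mul _ _ _ _)

theorem tensorLeft_apply {M N : ℕ} (A : TensorPow k M) : tensorLeft M N A =
    Matrix.reindexAlgEquiv ℂ ℂ (Fin.appendEquiv M N) (A ⊗ₖ (1 : TensorPow k N)) := rfl

theorem tensorRight_apply {M N : ℕ} (B : TensorPow k N) : tensorRight M N B =
    Matrix.reindexAlgEquiv ℂ ℂ (Fin.appendEquiv M N) ((1 : TensorPow k M) ⊗ₖ B) := rfl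

theorem tensorLeft_mul_tensorRight {M N : ℕ} (A : TensorPow k M) (B : TensorPow k N) :
    tensorLeft M N A * tensorRight M N B =
      Matrix.reindexAlgEquiv ℂ ℂ (Fin.appendEquiv M N) (A ⊗ₖ B) := by
  rw [tensorLeft_apply, tensorRight_apply, ← map_mul, ← Matrix.mul_kronecker_mul, mul_one, one_mul]

theorem tensorLeft_commute_tensorRight {M N : ℕ} (A : TensorPow k M) (B : TensorPow k N) :
    Commute (tensorLeft M N A) (tensorRight M N B) := by
  rw [Commute, SemiconjBy, tensorLeft_mul_tensorRight, tensorLeft_apply, tensorRight_apply,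
    ← map_mul, ← Matrix.mul_kronecker_mul, mul_one, one_mul]

theorem reindex_isHermitian {m n : Type*} [Fintype m] [DecidableEq m] [Fintype n] [DecidableEq n]
    (e : m ≃ n) {A : Matrix m m ℂ} (hA : A.IsHermitian) :
    (Matrix.reindexAlgEquiv ℂ ℂ e A).IsHermitian := by
  ext i j
  exact hA.apply _ _

theorem tensorLeft_isHermitian {M N : ℕ} {A : TensorPow k M} (hA : A.IsHermitian) :
    (tensorLeft M N A).IsHermitian := by
  rw [tensorLeft_apply]
  refine reindex_isHermitian _ ?_
  rw [Matrix.IsHermitian, Matrix.conjTranspose_kronecker, hA.eq, Matrix.conjTranspose_one]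

theorem tensorRight_isHermitian {M N : ℕ} {B : TensorPow k N} (hB : B.IsHermitian) :
    (tensorRight M N B).IsHermitian := by
  rw [tensorRight_apply]
  refine reindex_isHermitian _ ?_
  rw [Matrix.IsHermitian, Matrix.conjTranspose_kronecker, hB.eq, Matrix.conjTranspose_one]

theorem trace_reindexAlgEquiv {m n : Type*} [Fintype m] [DecidableEq m] [Fintype n] [DecidableEq n]
    (e : m ≃ n) (A : Matrix m m ℂ) : (Matrix.reindexAlgEquiv ℂ ℂ e A).trace = A.trace :=
  Equiv.sum_comp e.symm fun i => A i i

open scoped Matrix.Norms.L2Operator in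
theorem algHom_exp {m n : Type*} [Fintype m] [DecidableEq m] [Fintype n] [DecidableEq n]
    (φ : Matrix m m ℂ →ₐ[ℂ] Matrix n n ℂ) (A : Matrix m m ℂ) :
    φ (NormedSpace.exp A) = NormedSpace.exp (φ A) :=
  let _ : NormedAlgebra ℚ (Matrix m m ℂ) := .restrictScalars ℚ ℂ _
  NormedSpace.map_exp φ (LinearMap.continuous_of_finiteDimensional φ.toLinearMap) A

theorem trace_exp_tensorLeft_add_tensorRight {M N : ℕ} (A : TensorPow k M) (B : TensorPow k N) :
    (NormedSpace.exp (tensorLeft M N A + tensorRight M N B)).trace =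
      (NormedSpace.exp A).trace * (NormedSpace.exp B).trace := by
  rw [Matrix.exp_add_of_commute _ _ (tensorLeft_commute_tensorRight A B), ← algHom_exp,
    ← algHom_exp, tensorLeft_mul_tensorRight, trace_reindexAlgEquiv, Matrix.trace_kronecker]

theorem tensorLeft_eq_embed {M N : ℕ} (A : TensorPow k M) :
    tensorLeft M N A = embed (Nat.le_add_right M N) A := by
  ext f g
  change A (fun i => f (Fin.castAdd N i)) (fun i => g (Fin.castAdd N i)) *
    (1 : TensorPow k N) (fun i => f (Fin.natAdd M i)) (fun i => g (Fin.natAdd M i)) = _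
  simp only [embed, Matrix.of_apply, Matrix.one_apply, mul_ite, mul_one, mul_zero]
  have : ((fun i : Fin N => f (Fin.natAdd M i)) = fun i => g (Fin.natAdd M i)) ↔
      ∀ i : Fin (M + N), M ≤ i.1 → f i = g i := by
    rw [funext_iff]
    constructor
    · intro h i hi
      have := h ⟨i.1 - M, by omega⟩
      have e : Fin.natAdd M (⟨i.1 - M, by omega⟩ : Fin N) = i := Fin.ext (by simp; omega)
      simpa only [e] using this
    · exact fun h i => h _ (by simp)
  simp only [this]
  rfl

theorem tensorRight_elemTensor {M N : ℕ} (A : Fin N → Matrix (Fin k) (Fin k) ℂ) :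
    tensorRight M N (elemTensor A) = elemTensor (Fin.append (fun _ => 1) A) := by
  ext f g
  change (1 : TensorPow k M) (fun i => f (Fin.castAdd N i)) (fun i => g (Fin.castAdd N i)) *
    ∏ i, A i (f (Fin.natAdd M i)) (g (Fin.natAdd M i)) = _
  simp only [elemTensor, Matrix.of_apply, Fin.prod_univ_add, Fin.append_left, Fin.append_right]
  rw [← elemTensor_one]
  rfl

/-- A permutation of the last `N` sites extends to all sites by fixing the first `M`. This feeds the
induction in `exists_blockSum`. -/
theorem IsPermInvariant.comp_tensorRight {M N : ℕ} {φ : TensorPow k (M + N) →ₗ[ℂ] ℂ}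
    (h : IsPermInvariant φ) : IsPermInvariant (φ.comp (tensorRight M N).toLinearMap) := by
  intro π A
  let σ : Equiv.Perm (Fin (M + N)) :=
    finSumFinEquiv.permCongr (Equiv.sumCongr (Equiv.refl (Fin M)) π)
  have : (tensorRight M N).toLinearMap.comp (permute π) =
      (permute σ).comp ((tensorRight M N).toLinearMap : TensorPow k N →ₗ[ℂ] _) := by
    refine ext_elemTensor fun A => ?_
    simp only [LinearMap.comp_apply, permute_elemTensor, AlgHom.toLinearMap_apply,
      tensorRight_elemTensor]
    congr 1
    funext i
    refine Fin.addCases (fun i => ?_) (fun i => ?_) i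
    · simp [σ, Equiv.permCongr_def]
    · simp [σ, Equiv.permCongr_def]
  have := LinearMap.congr_fun this A
  simp only [LinearMap.comp_apply] at this ⊢
  rw [this, h]

theorem IsPermInvariant.tensorRight_embed {M N : ℕ} {φ : TensorPow k (M + N) →ₗ[ℂ] ℂ}
    (h : IsPermInvariant φ) (hMN : M ≤ N) (A : TensorPow k M) :
    φ (tensorRight M N (embed hMN A)) = φ (embed (Nat.le_add_right M N) A) := by
  -- The involution exchanging the first `M` sites with the next `M`; there is room because `M ≤ N`.
  let s : Fin (M + N) → Fin (M + N) := fun i =>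
    if h : i.1 < M then ⟨i.1 + M, by omega⟩ else if i.1 < M + M then ⟨i.1 - M, by omega⟩ else i
  have hs : Function.Involutive s := by
    have hv : ∀ i, (s i).1 =
        if i.1 < M then i.1 + M else if i.1 < M + M then i.1 - M else i.1 := by
      intro i; simp only [s]; split_ifs <;> rfl
    intro i
    refine Fin.ext ?_
    rw [hv, hv]
    split_ifs <;> omega
  have : (tensorRight M N).toLinearMap.comp (embedₗ hMN) =
      (permute hs.toPerm).comp (embedₗ (Nat.le_add_right M N) : TensorPow k M →ₗ[ℂ] _) := by
    refine ext_elemTensor fun A => ?_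
    simp only [LinearMap.comp_apply, embedₗ_apply, embed_elemTensor, permute_elemTensor,
      AlgHom.toLinearMap_apply, tensorRight_elemTensor]
    congr 1
    funext i
    change _ = if hi : (s i).1 < M then A ⟨(s i).1, hi⟩ else 1
    refine Fin.addCases (fun i => ?_) (fun i => ?_) i
    · rw [Fin.append_left, dif_neg]
      simp [s]
    · rw [Fin.append_right]
      by_cases hi : i.1 < M
      · have e : (s (Fin.natAdd M i)).1 = i.1 := by simp [s, hi]
        rw [dif_pos hi, dif_pos (by omega)]
        congr 1
        exact Fin.ext e.symm
      · have e : (s (Fin.natAdd M i)).1 = M + i.1 := by simp [s, hi]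
        rw [dif_neg hi, dif_neg (by omega)]
  have := LinearMap.congr_fun this A
  simp only [LinearMap.comp_apply, embedₗ_apply, AlgHom.toLinearMap_apply] at this
  rw [this, h]

/-- For an `m`-body observable `K`, the sum `B` of the copies of `K` over `q` disjoint blocks of
`m` sites inside `q m + r` sites. -/
theorem exists_blockSum {m : ℕ} {K : TensorPow k m} (hK : K.IsHermitian) (r q N : ℕ)
    (hN : N = q * m + r) :
    ∃ B : TensorPow k N, B.IsHermitian ∧
      (NormedSpace.exp B).trace = (NormedSpace.exp K).trace ^ q * (k : ℂ) ^ r ∧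
      ∀ φ : TensorPow k N →ₗ[ℂ] ℂ, IsPermInvariant φ → ∀ c : ℂ,
        (∀ h : m ≤ N, φ (embed h K) = c) → φ B = q * c := by
  -- Copies on disjoint blocks commute, so `Tr exp` factorises, and the `r` idle sites contribute `k
  -- ^ r`. The value `c` is prescribed only when `m ≤ N`, since for `q = 0` there may be fewer than
  -- `m` sites.
  induction q generalizing N with
  | zero =>
    obtain rfl : N = r := by omega
    refine ⟨0, Matrix.isHermitian_zero, ?_, by simp⟩
    rw [NormedSpace.exp_zero, Matrix.trace_one]
    simp
  | succ q ih =>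
    obtain ⟨B, hB, htr, hφ⟩ := ih (q * m + r) rfl
    obtain rfl : N = m + (q * m + r) := by rw [hN]; ring
    refine ⟨tensorLeft _ _ K + tensorRight _ _ B,
      (tensorLeft_isHermitian hK).add (tensorRight_isHermitian hB), ?_, ?_⟩
    · rw [trace_exp_tensorLeft_add_tensorRight, htr]
      ring
    · intro φ hφi c hc
      have := hφ _ hφi.comp_tensorRight c fun h => by
        rw [LinearMap.comp_apply, AlgHom.toLinearMap_apply, hφi.tensorRight_embed, hc]
      rw [LinearMap.comp_apply, AlgHom.toLinearMap_apply] at this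
      rw [map_add, this, tensorLeft_eq_embed, hc]
      push_cast
      ring

end BlockSums

/-! ### Quantum de Finetti theorem: extreme exchangeable states are product states. -/

section DeFinetti

/-- The correlation functions of an exchangeable state, `φ [a₁, …, aₙ] = ω(a₁ ⊗ ⋯ ⊗ aₙ)`,
restricted to at most `N` observables. -/
structure IsExchangeableUpTo (N : ℕ) (φ : List (Matrix (Fin k) (Fin k) ℂ) → ℂ) : Prop where
  nil : φ [] = 1
  perm : ∀ l l', l.length ≤ N → l.Perm l' → φ l = φ l'
  add : ∀ a b l, l.length < N → φ ((a + b) :: l) = φ (a :: l) + φ (b :: l)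
  smul : ∀ (c : ℂ) a l, l.length < N → φ ((c • a) :: l) = c * φ (a :: l)
  one : ∀ l, l.length < N → φ (1 :: l) = φ l
  nonneg : ∀ l, l.length ≤ N → (∀ a ∈ l, a.PosSemidef) → 0 ≤ φ l

/-- The correlation functions of exchangeable states of infinitely many sites. -/
def exchangeable (k : ℕ) : Set (List (Matrix (Fin k) (Fin k) ℂ) → ℂ) :=
  {φ | ∀ N, IsExchangeableUpTo N φ}

variable {N : ℕ} {φ : List (Matrix (Fin k) (Fin k) ℂ) → ℂ}

theorem IsExchangeableUpTo.mono (h : IsExchangeableUpTo N φ) {M : ℕ} (hM : M ≤ N) :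
    IsExchangeableUpTo M φ where
  nil := h.nil
  perm l l' hl := h.perm l l' (hl.trans hM)
  add a b l hl := h.add a b l (hl.trans_le hM)
  smul c a l hl := h.smul c a l (hl.trans_le hM)
  one l hl := h.one l (hl.trans_le hM)
  nonneg l hl := h.nonneg l (hl.trans hM)

theorem IsExchangeableUpTo.add_sum_four (h : IsExchangeableUpTo N φ)
    {l : List (Matrix (Fin k) (Fin k) ℂ)} (hl : l.length < N)
    (c : Fin 4 → ℂ) (x : Fin 4 → Matrix (Fin k) (Fin k) ℂ) :
    φ ((∑ i, c i • x i) :: l) = ∑ i, c i * φ (x i :: l) := by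
  simp only [Fin.sum_univ_four, h.add _ _ l hl, h.smul _ _ l hl]

open scoped MatrixOrder Matrix.Norms.L2Operator in
theorem posSemidef_smul_one_sub {n : Type*} [Fintype n] [DecidableEq n] {x : Matrix n n ℂ}
    (hx : x.PosSemidef) {r : ℝ} (hr : ‖x‖ ≤ r) : ((r : ℂ) • (1 : Matrix n n ℂ) - x).PosSemidef := by
  rcases isEmpty_or_nonempty n with hn | hn
  · rw [Subsingleton.elim ((r : ℂ) • (1 : Matrix n n ℂ) - x) 0]
    exact Matrix.PosSemidef.zero
  have hsa : IsSelfAdjoint x := hx.1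
  have h1 : x ≤ algebraMap ℝ (Matrix n n ℂ) r :=
    hsa.le_algebraMap_norm_self.trans (algebraMap_le_algebraMap.mpr hr)
  have : algebraMap ℝ (Matrix n n ℂ) r = (r : ℂ) • 1 := by
    rw [Algebra.algebraMap_eq_smul_one]; ext i j; simp [Matrix.one_apply]
  rw [this] at h1
  exact Matrix.le_iff.mp h1

-- Put the positive matrix `r - x` in the first slot and use additivity.
open scoped Matrix.Norms.L2Operator in
theorem IsExchangeableUpTo.cons_le (h : IsExchangeableUpTo N φ)
    {l : List (Matrix (Fin k) (Fin k) ℂ)} (hl : l.length < N) (hpos : ∀ a ∈ l, a.PosSemidef)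
    {x : Matrix (Fin k) (Fin k) ℂ} (hx : x.PosSemidef) {r : ℝ} (hr : ‖x‖ ≤ r) :
    φ (x :: l) ≤ r * φ l := by
  have h1 := h.add x ((r : ℂ) • 1 - x) l hl
  rw [add_sub_cancel, h.smul _ _ l hl, h.one l hl] at h1
  rw [h1]
  refine le_add_of_nonneg_right (h.nonneg _ (by simpa using hl) ?_)
  intro a ha
  rcases List.mem_cons.mp ha with rfl | ha
  · exact posSemidef_smul_one_sub hx hr
  · exact hpos a ha

-- The constant depends on `l` alone, which is what compactness needs. The head of `l` is split into
-- four positive parts; each is moved by symmetry into the positive tail `e`, where `cons_le`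
-- controls it. The tail exists for this induction.
open scoped MatrixOrder Matrix.Norms.L2Operator in
theorem exists_exchangeable_bound (l : List (Matrix (Fin k) (Fin k) ℂ)) :
    ∃ C : ℝ, 0 ≤ C ∧ ∀ (N : ℕ) (φ : List (Matrix (Fin k) (Fin k) ℂ) → ℂ),
      IsExchangeableUpTo N φ → ∀ e : List (Matrix (Fin k) (Fin k) ℂ), (∀ a ∈ e, a.PosSemidef) →
        (l ++ e).length ≤ N → ‖φ (l ++ e)‖ ≤ C * ‖φ e‖ := by
  induction l with
  | nil => exact ⟨1, zero_le_one, fun N φ _ e _ _ => by simp⟩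
  | cons a l ih =>
    obtain ⟨C, hC, ih⟩ := ih
    obtain ⟨x, hx, hxn, ha⟩ := CStarAlgebra.exists_sum_four_nonneg a
    refine ⟨∑ _i : Fin 4, C * ‖a‖, by positivity, fun N φ h e he hl => ?_⟩
    have hl' : (l ++ e).length < N := by simpa using hl
    rw [List.cons_append, ha, h.add_sum_four hl', Finset.sum_mul, ← ha]
    refine (norm_sum_le _ _).trans (Finset.sum_le_sum fun i _ => ?_)
    have hxi : (x i).PosSemidef := Matrix.nonneg_iff_posSemidef.mp (hx i)
    have he' : ∀ b ∈ x i :: e, b.PosSemidef := fun b hb => by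
      rcases List.mem_cons.mp hb with rfl | hb
      · exact hxi
      · exact he b hb
    have hle : e.length < N := by simp only [List.length_append] at hl'; omega
    have hperm : φ (x i :: (l ++ e)) = φ (l ++ x i :: e) :=
      h.perm _ _ (by simpa using hl) List.perm_middle.symm
    have h1 := ih N φ h (x i :: e) he' (by simp only [List.length_append, List.length_cons] at *; omega)
    have h2 := h.cons_le hle he hxi (hxn i)
    have h0 := h.nonneg (x i :: e) (by simpa using hle) he'
    have h3 : ‖φ (x i :: e)‖ ≤ ‖a‖ * ‖φ e‖ := by
      calc _ ≤ ‖(‖a‖ : ℂ) * φ e‖ := CStarAlgebra.norm_le_norm_of_nonneg_of_le h0 h2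
        _ = _ := by simp
    calc ‖Complex.I ^ (i : ℕ) * φ (x i :: (l ++ e))‖ = ‖φ (l ++ x i :: e)‖ := by
          rw [norm_mul, norm_pow, Complex.norm_I, one_pow, one_mul, hperm]
      _ ≤ C * (‖a‖ * ‖φ e‖) := h1.trans (mul_le_mul_of_nonneg_left h3 hC)
      _ = _ := by ring

theorem exists_exchangeable_norm_le (l : List (Matrix (Fin k) (Fin k) ℂ)) :
    ∃ C : ℝ, ∀ (N : ℕ) (φ : List (Matrix (Fin k) (Fin k) ℂ) → ℂ),
      IsExchangeableUpTo N φ → l.length ≤ N → ‖φ l‖ ≤ C := by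
  obtain ⟨C, -, h⟩ := exists_exchangeable_bound l
  refine ⟨C, fun N φ hφ hl => ?_⟩
  have := h N φ hφ [] (by simp) (by simpa using hl)
  rwa [List.append_nil, hφ.nil, norm_one, mul_one] at this

/-- Every axiom is a closed condition on finitely many coordinates and needs to hold only eventually
for each length. Limits of finite systems of growing size are therefore exchangeable without a
length restriction. -/
theorem mem_exchangeable_of_tendsto {ι : Type*} {F : Filter ι} [F.NeBot]
    {Φ : ι → List (Matrix (Fin k) (Fin k) ℂ) → ℂ}
    (h : ∀ N, ∀ᶠ i in F, IsExchangeableUpTo N (Φ i)) (hlim : Tendsto Φ F (𝓝 φ)) :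
    φ ∈ exchangeable k := by
  have hl : ∀ l, Tendsto (fun i => Φ i l) F (𝓝 (φ l)) := tendsto_pi_nhds.mp hlim
  intro N
  refine ⟨?_, fun l l' hlen hp => ?_, fun a b l hlen => ?_, fun c a l hlen => ?_,
    fun l hlen => ?_, fun l hlen hpos => ?_⟩
  · exact tendsto_nhds_unique_of_eventuallyEq (hl []) tendsto_const_nhds
      ((h N).mono fun i hi => hi.nil)
  · exact tendsto_nhds_unique_of_eventuallyEq (hl l) (hl l')
      ((h N).mono fun i hi => hi.perm l l' hlen hp)
  · exact tendsto_nhds_unique_of_eventuallyEq (hl _) ((hl _).add (hl _))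
      ((h N).mono fun i hi => hi.add a b l hlen)
  · exact tendsto_nhds_unique_of_eventuallyEq (hl _) ((hl _).const_mul c)
      ((h N).mono fun i hi => hi.smul c a l hlen)
  · exact tendsto_nhds_unique_of_eventuallyEq (hl _) (hl _)
      ((h N).mono fun i hi => hi.one l hlen)
  · exact ge_of_tendsto (hl l) ((h N).mono fun i hi => hi.nonneg l hlen hpos)

/-- Tychonoff's theorem for pointwise convergence on lists, using the uniform bounds. -/
theorem isCompact_exchangeable : IsCompact (exchangeable k) := by
  choose C hC using exists_exchangeable_norm_le (k := k)
  refine (isCompact_univ_pi fun l => isCompact_closedBall (0 : ℂ) (C l)).of_isClosed_subset ?_ ?_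
  · rw [isClosed_iff_forall_filter]
    intro φ F hF hFK hlim
    have := hF
    refine mem_exchangeable_of_tendsto (Φ := id) (F := F) (fun N => ?_) hlim
    filter_upwards [le_principal_iff.mp hFK] with ψ hψ using hψ N
  · intro φ hφ l _
    simpa using hC l l.length φ (hφ _) le_rfl

theorem convex_exchangeable : Convex ℝ (exchangeable k) := by
  intro φ hφ ψ hψ s t hs ht hst N
  have hφ := hφ N
  have hψ := hψ N
  have hst' : (s : ℂ) + t = 1 := by exact_mod_cast hst
  have e : ∀ l, (s • φ + t • ψ) l = s * φ l + t * ψ l := fun l => by simp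
  refine ⟨?_, fun l l' hlen hp => ?_, fun a b l hlen => ?_, fun c a l hlen => ?_,
    fun l hlen => ?_, fun l hlen hpos => ?_⟩ <;> simp only [e]
  · rw [hφ.nil, hψ.nil, mul_one, mul_one, hst']
  · rw [hφ.perm l l' hlen hp, hψ.perm l l' hlen hp]
  · rw [hφ.add a b l hlen, hψ.add a b l hlen]; ring
  · rw [hφ.smul c a l hlen, hψ.smul c a l hlen]; ring
  · rw [hφ.one l hlen, hψ.one l hlen]
  · have h1 := hφ.nonneg l hlen hpos
    have h2 := hψ.nonneg l hlen hpos
    have h3 : (0 : ℂ) ≤ s := by exact_mod_cast hs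
    have h4 : (0 : ℂ) ≤ t := by exact_mod_cast ht
    positivity

theorem exists_ofReal_of_nonneg {z : ℂ} (hz : 0 ≤ z) : ∃ u : ℝ, 0 ≤ u ∧ z = u :=
  ⟨z.re, (Complex.le_def.mp hz).1, Complex.ext rfl (Complex.le_def.mp hz).2.symm⟩

/-- Conditioning an exchangeable state on a positive one-site observable. -/
theorem exchangeable_condition (hφ : φ ∈ exchangeable k) {a : Matrix (Fin k) (Fin k) ℂ}
    (ha : a.PosSemidef) (hne : φ [a] ≠ 0) :
    (fun l => (φ [a])⁻¹ * φ (a :: l)) ∈ exchangeable k := by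
  intro N
  have h := hφ (N + 2)
  have sw : ∀ x l, l.length < N → φ (a :: x :: l) = φ (x :: a :: l) := fun x l hl =>
    h.perm _ _ (by simp; omega) (List.Perm.swap _ _ _)
  refine ⟨inv_mul_cancel₀ hne, fun l l' hlen hp => ?_, fun x y l hlen => ?_,
    fun c x l hlen => ?_, fun l hlen => ?_, fun l hlen hpos => ?_⟩
  · rw [h.perm (a :: l) (a :: l') (by simp; omega) (hp.cons a)]
  · rw [sw _ l hlen, sw _ l hlen, sw _ l hlen, h.add _ _ _ (by simp; omega), mul_add]
  · rw [sw _ l hlen, sw _ l hlen, h.smul _ _ _ (by simp; omega)]; ring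
  · rw [sw _ l hlen, h.one _ (by simp; omega)]
  · have h0 : 0 ≤ φ [a] := h.nonneg _ (by simp) (by simpa using ha)
    have h1 : 0 ≤ φ (a :: l) := h.nonneg _ (by simp; omega) (by simpa using ⟨ha, hpos⟩)
    obtain ⟨u, hu, hu'⟩ := exists_ofReal_of_nonneg h0
    rw [hu', ← Complex.ofReal_inv]
    exact mul_nonneg (by exact_mod_cast inv_nonneg.mpr hu) h1

-- If `b` and `c` are positive and `b + c` is a multiple of the identity, `φ` is a convex
-- combination of its conditionings on `b` and on `c`. Extremality forces `φ` to equal the first,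
-- which is the factorisation for `b`.
open scoped MatrixOrder Matrix.Norms.L2Operator in
theorem extreme_exchangeable_cons (hφ : φ ∈ (exchangeable k).extremePoints ℝ)
    (a : Matrix (Fin k) (Fin k) ℂ) (l : List (Matrix (Fin k) (Fin k) ℂ)) :
    φ (a :: l) = φ [a] * φ l := by
  obtain ⟨hK, hext⟩ := mem_extremePoints.mp hφ
  have hadd : ∀ x y l, φ ((x + y) :: l) = φ (x :: l) + φ (y :: l) := fun x y l =>
    (hK (l.length + 1)).add x y l (by simp)
  have hsmul : ∀ (c : ℂ) x l, φ ((c • x) :: l) = c * φ (x :: l) := fun c x l =>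
    (hK (l.length + 1)).smul c x l (by simp)
  have hone : ∀ l, φ (1 :: l) = φ l := fun l => (hK (l.length + 1)).one l (by simp)
  have hnil := (hK 0).nil
  have hpos : ∀ x : Matrix (Fin k) (Fin k) ℂ, x.PosSemidef → ∀ l, φ (x :: l) = φ [x] * φ l := by
    intro x hx l
    -- With `b = s + x` and `c = 2s - x`, both expectations are at least `s > 0`, so both
    -- conditionings are defined, and `b + c = 3s`.
    set s : ℝ := ‖x‖ + 1 with hs
    have hs0 : 0 < s := by positivity
    have hs1 : ((s : ℂ) • (1 : Matrix (Fin k) (Fin k) ℂ)).PosSemidef :=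
      Matrix.PosSemidef.one.smul (by exact_mod_cast hs0.le)
    set b := (s : ℂ) • (1 : Matrix (Fin k) (Fin k) ℂ) + x with hb
    set c := (s : ℂ) • (1 : Matrix (Fin k) (Fin k) ℂ) +
      ((s : ℂ) • (1 : Matrix (Fin k) (Fin k) ℂ) - x) with hc
    have hsx := posSemidef_smul_one_sub hx (show ‖x‖ ≤ s by linarith)
    have hbp : b.PosSemidef := hs1.add hx
    have hcp : c.PosSemidef := hs1.add hsx
    have hx0 : 0 ≤ φ [x] := (hK 1).nonneg _ (by simp) (by simpa using hx)
    have hx1 : 0 ≤ φ [(s : ℂ) • (1 : Matrix (Fin k) (Fin k) ℂ) - x] :=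
      (hK 1).nonneg _ (by simp) (by simpa using hsx)
    have e1 : ∀ l, φ (b :: l) = s * φ l + φ (x :: l) := fun l => by rw [hb, hadd, hsmul, hone]
    have e2 : ∀ l, φ (b :: l) + φ (c :: l) = 3 * s * φ l := fun l => by
      have : b + c = (3 * s : ℂ) • 1 := by rw [hb, hc]; module
      rw [← hadd, this, hsmul, hone]
    have hsC : (0 : ℂ) < s := by exact_mod_cast hs0
    have hb0 : 0 < φ [b] := by
      rw [e1, hnil, mul_one]; exact add_pos_of_pos_of_nonneg hsC hx0
    have hc0 : 0 < φ [c] := by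
      rw [hc, hadd, hsmul, hone, hnil, mul_one]; exact add_pos_of_pos_of_nonneg hsC hx1
    obtain ⟨u, -, hu⟩ := exists_ofReal_of_nonneg hb0.le
    obtain ⟨v, -, hv⟩ := exists_ofReal_of_nonneg hc0.le
    have hu0 : 0 < u := by rw [hu] at hb0; exact_mod_cast hb0
    have hv0 : 0 < v := by rw [hv] at hc0; exact_mod_cast hc0
    have huv : u + v = 3 * s := by
      have := e2 []
      rw [hu, hv, hnil, mul_one] at this
      exact_mod_cast this
    have hmemb := exchangeable_condition hK hbp hb0.ne'
    have hmemc := exchangeable_condition hK hcp hc0.ne'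
    have hseg : φ ∈ openSegment ℝ (fun l => (φ [b])⁻¹ * φ (b :: l))
        (fun l => (φ [c])⁻¹ * φ (c :: l)) := by
      refine ⟨u / (3 * s), v / (3 * s), by positivity, by positivity, ?_, ?_⟩
      · rw [← add_div, huv, div_self (by positivity)]
      · funext l
        have h3 : (s : ℂ) ≠ 0 := hsC.ne'
        have hu' : (u : ℂ) ≠ 0 := by exact_mod_cast hu0.ne'
        have hv' : (v : ℂ) ≠ 0 := by exact_mod_cast hv0.ne'
        simp only [Pi.add_apply, Pi.smul_apply, Complex.real_smul, hu, hv]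
        push_cast
        field_simp
        linear_combination e2 l
    have h1 := (hext _ hmemb _ hmemc hseg).1
    have h2 := congrFun h1 l
    beta_reduce at h2
    rw [inv_mul_eq_iff_eq_mul₀ hb0.ne', e1, e1, hnil] at h2
    linear_combination h2
  obtain ⟨x, hx, -, ha⟩ := CStarAlgebra.exists_sum_four_nonneg a
  rw [ha, (hK (l.length + 1)).add_sum_four (by simp), (hK 1).add_sum_four (l := []) (by simp),
    Finset.sum_mul]
  refine Finset.sum_congr rfl fun i _ => ?_
  rw [hpos _ (Matrix.nonneg_iff_posSemidef.mp (hx i)) l, mul_assoc]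

/-- Extreme exchangeable states are product states. -/
theorem extreme_exchangeable_eq_prod (hφ : φ ∈ (exchangeable k).extremePoints ℝ) :
    ∃ ω : StateSpace (Matrix (Fin k) (Fin k) ℂ), ∀ l, φ l = (l.map fun a => ω.1 a).prod := by
  have hK := hφ.1
  let ω₀ : Matrix (Fin k) (Fin k) ℂ →ₗ[ℂ] ℂ :=
    { toFun := fun a => φ [a]
      map_add' := fun a b => (hK 1).add a b [] (by simp)
      map_smul' := fun c a => (hK 1).smul c a [] (by simp) }
  let ω : WeakDual ℂ (Matrix (Fin k) (Fin k) ℂ) :=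
    StrongDual.toWeakDual ⟨ω₀, LinearMap.continuous_of_finiteDimensional ω₀⟩
  have hω : ω ∈ StateSpace (Matrix (Fin k) (Fin k) ℂ) := by
    refine ⟨fun a => (hK 1).nonneg _ (by simp) ?_, ?_⟩
    · intro b hb
      rw [List.mem_singleton.mp hb]
      exact Matrix.posSemidef_conjTranspose_mul_self a
    · exact ((hK 1).one [] (by simp)).trans (hK 1).nil
  refine ⟨⟨ω, hω⟩, fun l => ?_⟩
  induction l with
  | nil => exact (hK 0).nil
  | cons a l ih =>
    rw [extreme_exchangeable_cons hφ, ih, List.map_cons, List.prod_cons]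
    rfl

/-- The expectation of an `m`-body observable in an exchangeable state. -/
noncomputable def exchangeableExpectation {m : ℕ} (b : TensorPow k m)
    (φ : List (Matrix (Fin k) (Fin k) ℂ) → ℂ) : ℂ :=
  ∑ f, ∑ g, b f g * φ (List.ofFn fun i => Matrix.single (f i) (g i) 1)

theorem continuous_exchangeableExpectation {m : ℕ} (b : TensorPow k m) :
    Continuous (exchangeableExpectation b) := by
  unfold exchangeableExpectation
  fun_prop

/-- On exchangeable states, the expectation of an observable is bounded below by its values on
product states. -/
theorem le_exchangeableExpectation {m : ℕ} {b : TensorPow k m} {c : ℝ}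
    (hc : ∀ ω : StateSpace (Matrix (Fin k) (Fin k) ℂ), c ≤ (productFunctional ω.1 m b).re)
    (hφ : φ ∈ exchangeable k) : c ≤ (exchangeableExpectation b φ).re := by
  have hconv : Convex ℝ {ψ | c ≤ (exchangeableExpectation b ψ).re} := by
    refine convex_halfSpace_ge (𝕜 := ℝ) (f := fun ψ => (exchangeableExpectation b ψ).re) ⟨?_, ?_⟩ c
    · intro φ ψ
      simp only [exchangeableExpectation, Pi.add_apply, mul_add, Finset.sum_add_distrib,
        Complex.add_re]
    · intro r φ
      simp only [exchangeableExpectation, Pi.smul_apply, Complex.real_smul, smul_eq_mul]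
      rw [← Complex.re_ofReal_mul, Finset.mul_sum]
      simp only [Finset.mul_sum]
      congr 2
      funext f
      refine Finset.sum_congr rfl fun g _ => by ring
  have hclosed : IsClosed {ψ | c ≤ (exchangeableExpectation b ψ).re} :=
    isClosed_le continuous_const
      (Complex.continuous_re.comp (continuous_exchangeableExpectation b))
  have hsub : (exchangeable k).extremePoints ℝ ⊆ {ψ | c ≤ (exchangeableExpectation b ψ).re} := by
    intro ψ hψ
    obtain ⟨ω, hω⟩ := extreme_exchangeable_eq_prod hψ
    have : exchangeableExpectation b ψ = productFunctional ω.1 m b := by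
      change _ = ∑ f, ∑ g, _
      refine Finset.sum_congr rfl fun f _ => Finset.sum_congr rfl fun g _ => ?_
      rw [hω, List.map_ofFn, List.prod_ofFn]
      rfl
    rw [Set.mem_ofPred_eq, this]
    exact hc ω
  -- Krein–Milman: the closed half-space contains all extreme points, hence the whole set.
  rw [← closure_convexHull_extremePoints isCompact_exchangeable convex_exchangeable] at hφ
  exact closure_minimal (convexHull_min hsub hconv) hclosed hφ

end DeFinetti

/-! ### From finite permutation invariant states to exchangeable limits. -/

section Marginals

variable {N : ℕ}

/-- The correlation functions of a functional on `M_k(ℂ)^{⊗N}`. -/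
noncomputable def correlation (φ : TensorPow k N →ₗ[ℂ] ℂ)
    (l : List (Matrix (Fin k) (Fin k) ℂ)) : ℂ :=
  φ (elemTensor fun i : Fin N => l.getD i 1)

/-- The prefix `p` is carried along so that the `cons` case of the induction closes; only the `swap`
case uses invariance, under the transposition of sites `p.length` and `p.length + 1`. -/
theorem correlation_append_perm {φ : TensorPow k N →ₗ[ℂ] ℂ} (h : IsPermInvariant φ)
    {l l' : List (Matrix (Fin k) (Fin k) ℂ)} (hp : l.Perm l') :
    ∀ p : List (Matrix (Fin k) (Fin k) ℂ), (p ++ l).length ≤ N →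
      correlation φ (p ++ l) = correlation φ (p ++ l') := by
  induction hp with
  | nil => exact fun _ _ => rfl
  | cons x _ ih =>
    intro p hl
    have := ih (p ++ [x]) (by simpa using hl)
    simpa using this
  | swap x y l =>
    intro p hl
    simp only [List.length_append, List.length_cons] at hl
    have hp₀ : p.length < N := by omega
    have hp₁ : p.length + 1 < N := by omega
    let π : Equiv.Perm (Fin N) := Equiv.swap ⟨p.length, hp₀⟩ ⟨p.length + 1, hp₁⟩
    unfold correlation
    rw [← h π, permute_elemTensor]
    congr 2
    funext i
    rcases lt_trichotomy i.1 p.length with hi | hi | hi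
    · have : π.symm i = i := Equiv.swap_apply_of_ne_of_ne
        (by simp [Fin.ext_iff]; omega) (by simp [Fin.ext_iff]; omega)
      rw [this, List.getD_append _ _ _ _ hi, List.getD_append _ _ _ _ hi]
    · obtain rfl : i = ⟨p.length, hp₀⟩ := Fin.ext hi
      have : π.symm ⟨p.length, hp₀⟩ = ⟨p.length + 1, hp₁⟩ := Equiv.swap_apply_left _ _
      rw [this, List.getD_append_right _ _ _ _ (by simp), List.getD_append_right _ _ _ _ (by simp)]
      simp
    · by_cases hi' : i.1 = p.length + 1
      · obtain rfl : i = ⟨p.length + 1, hp₁⟩ := Fin.ext hi'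
        have : π.symm ⟨p.length + 1, hp₁⟩ = ⟨p.length, hp₀⟩ :=
          Equiv.swap_apply_right _ _
        rw [this, List.getD_append_right _ _ _ _ (by simp),
          List.getD_append_right _ _ _ _ (by simp)]
        simp
      · have : π.symm i = i := Equiv.swap_apply_of_ne_of_ne
          (by simp [Fin.ext_iff]; omega) (by simp [Fin.ext_iff]; omega)
        rw [this, List.getD_append_right _ _ _ _ (by omega),
          List.getD_append_right _ _ _ _ (by omega)]
        obtain ⟨j, hj⟩ : ∃ j, i.1 - p.length = j + 2 := ⟨i.1 - p.length - 2, by omega⟩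
        rw [hj]
        rfl
  | trans h₁ _ ih₁ ih₂ =>
    intro p hl
    rw [ih₁ p hl, ih₂ p (by simpa [h₁.length_eq] using hl)]

/-- Isolates the head as an update at site `0` of a tensor not involving it, so that linearity in
one slot applies. -/
theorem elemTensor_getD_cons [NeZero N] (a : Matrix (Fin k) (Fin k) ℂ)
    (l : List (Matrix (Fin k) (Fin k) ℂ)) :
    (elemTensor fun i : Fin N => (a :: l).getD i 1) =
      elemTensor (Function.update (fun i : Fin N => (1 :: l).getD i 1) 0 a) := by
  congr 1
  funext i
  by_cases hi : i = 0
  · subst hi; simp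
  · rw [Function.update_of_ne hi]
    obtain ⟨j, hj⟩ : ∃ j, i.1 = j + 1 := ⟨i.1 - 1, by
      have : i.1 ≠ 0 := fun h => hi (Fin.ext (by simpa using h))
      omega⟩
    rw [hj]
    rfl

theorem correlation_isExchangeableUpTo {ω : WeakDual ℂ (TensorPow k N)}
    (hω : ω ∈ StateSpace (TensorPow k N)) (h : IsPermInvariant ω.toLinearMap) :
    IsExchangeableUpTo N (correlation ω.toLinearMap) := by
  have hperm : ∀ l l' : List (Matrix (Fin k) (Fin k) ℂ), l.length ≤ N → l.Perm l' →
      correlation ω.toLinearMap l = correlation ω.toLinearMap l' := fun l l' hl hp =>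
    correlation_append_perm h hp [] (by simpa using hl)
  refine ⟨?_, hperm, fun a b l hl => ?_, fun c a l hl => ?_, fun l hl => ?_,
    fun l _ hpos => ?_⟩
  · simp only [correlation, List.getD_nil]
    rw [elemTensor_one]
    exact hω.2
  · have : NeZero N := ⟨by omega⟩
    simp only [correlation, elemTensor_getD_cons, elemTensor_update_add, map_add]
  · have : NeZero N := ⟨by omega⟩
    simp only [correlation, elemTensor_getD_cons, elemTensor_update_smul, map_smul, smul_eq_mul]
  -- Moved to the end, the extra `1` coincides with the padding value of `getD`.
  · rw [hperm (1 :: l) (l ++ [1]) (by simpa using hl) (List.perm_append_singleton 1 l).symm]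
    unfold correlation
    congr 2
    funext i
    rcases lt_or_ge i.1 l.length with hi | hi
    · rw [List.getD_append _ _ _ _ hi]
    · rw [List.getD_append_right _ _ _ _ hi, List.getD_eq_default _ _ hi]
      rcases Nat.eq_zero_or_pos (i.1 - l.length) with h0 | h0
      · rw [h0]; rfl
      · exact List.getD_eq_default _ _ (by simp; omega)
  · refine state_apply_nonneg hω (elemTensor_posSemidef fun i => ?_)
    rcases lt_or_ge i.1 l.length with hi | hi
    · rw [List.getD_eq_getElem _ _ hi]
      exact hpos _ (List.getElem_mem hi)
    · rw [List.getD_eq_default _ _ hi]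
      exact Matrix.PosSemidef.one

theorem exchangeableExpectation_correlation {m : ℕ} (hm : m ≤ N) (φ : TensorPow k N →ₗ[ℂ] ℂ)
    (b : TensorPow k m) : exchangeableExpectation b (correlation φ) = φ (embed hm b) := by
  conv_rhs => rw [eq_sum_elemTensor b, ← embedₗ_apply]
  simp only [map_sum, map_smul, embedₗ_apply, embed_elemTensor, smul_eq_mul]
  refine Finset.sum_congr rfl fun f _ => Finset.sum_congr rfl fun g _ => ?_
  unfold correlation
  congr 3
  funext i
  by_cases hi : i.1 < m
  · rw [dif_pos hi, List.getD_eq_getElem _ _ (by simpa using hi)]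
    simp
  · rw [dif_neg hi, List.getD_eq_default _ _ (by simpa using hi)]

/-- For large `N`, permutation invariant states of `N` sites have `m`-body energies almost bounded
below by those of product states. -/
theorem eventually_le_of_isPermInvariant {m : ℕ} {b : TensorPow k m} {c : ℝ}
    (hc : ∀ ω : StateSpace (Matrix (Fin k) (Fin k) ℂ), c ≤ (productFunctional ω.1 m b).re)
    {ε : ℝ} (hε : 0 < ε) :
    ∃ N₀ : ℕ, ∀ N, N₀ ≤ N → ∀ (hm : m ≤ N) (ω : WeakDual ℂ (TensorPow k N)),
      ω ∈ StateSpace (TensorPow k N) → IsPermInvariant ω.toLinearMap →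
        c - ε ≤ (ω (embed hm b)).re := by
  by_contra! hcon
  choose N hN hm ω hω hinv hlt using hcon
  -- Counterexamples exist on `N i ≥ i` sites. Their correlations are bounded, hence converge along
  -- an ultrafilter to an exchangeable state whose expectation is at most `c - ε`, a contradiction.
  let U : Ultrafilter ℕ := Ultrafilter.of atTop
  have hU : (U : Filter ℕ) ≤ atTop := Ultrafilter.of_le atTop
  let Φ : ℕ → List (Matrix (Fin k) (Fin k) ℂ) → ℂ := fun i => correlation (ω i).toLinearMap
  have hΦ : ∀ M, ∀ᶠ i in (U : Filter ℕ), IsExchangeableUpTo M (Φ i) := fun M =>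
    hU ((eventually_ge_atTop M).mono fun i hi =>
      (correlation_isExchangeableUpTo (hω i) (hinv i)).mono (hi.trans (hN i)))
  have hlim : ∀ l, ∃ z, Tendsto (fun i => Φ i l) U (𝓝 z) := by
    intro l
    obtain ⟨C, hC⟩ := exists_exchangeable_norm_le l
    obtain ⟨z, -, hz⟩ := (isCompact_closedBall (0 : ℂ) C).ultrafilter_le_nhds
      (U.map fun i => Φ i l) (by
        rw [le_principal_iff]
        change ∀ᶠ i in (U : Filter ℕ), Φ i l ∈ Metric.closedBall 0 C
        filter_upwards [hΦ l.length] with i hi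
        simpa using hC _ _ hi le_rfl)
    exact ⟨z, hz⟩
  choose φ hφ using hlim
  have hlim' : Tendsto Φ U (𝓝 φ) := tendsto_pi_nhds.mpr hφ
  have h1 := le_exchangeableExpectation hc (mem_exchangeable_of_tendsto hΦ hlim')
  have h2 : Tendsto (fun i => (exchangeableExpectation b (Φ i)).re) U
      (𝓝 (exchangeableExpectation b φ).re) :=
    ((Complex.continuous_re.comp (continuous_exchangeableExpectation b)).tendsto _).comp hlim'
  have h3 : (exchangeableExpectation b φ).re ≤ c - ε := by
    refine le_of_tendsto h2 (Eventually.of_forall fun i => ?_)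
    rw [exchangeableExpectation_correlation (hm i)]
    exact (hlt i).le
  linarith

end Marginals

/-! ### Weak-* compactness of the state space. -/

section Compactness

variable {n : Type*} [Fintype n] [DecidableEq n]

-- The factor `4` counts the positive parts of `A`; this crude bound is enough for Banach–Alaoglu.
open scoped MatrixOrder Matrix.Norms.L2Operator in
theorem norm_state_apply_le {ω : WeakDual ℂ (Matrix n n ℂ)} (hω : ω ∈ StateSpace (Matrix n n ℂ))
    (A : Matrix n n ℂ) : ‖ω A‖ ≤ 4 * ‖A‖ := by
  obtain ⟨x, hx, hxn, hA⟩ := CStarAlgebra.exists_sum_four_nonneg A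
  have h1 : ‖ω A‖ ≤ ∑ _i : Fin 4, ‖A‖ := by
    conv_lhs => rw [hA]
    rw [map_sum]
    refine (norm_sum_le _ _).trans (Finset.sum_le_sum fun i _ => ?_)
    have hh : (x i).IsHermitian := (Matrix.nonneg_iff_posSemidef.mp (hx i)).1
    rw [map_smul, norm_smul, norm_pow, Complex.norm_I, one_pow, one_mul,
      state_apply_eq_re hω hh, Complex.norm_real]
    exact (abs_state_re_le hω hh).trans (hxn i)
  simpa using h1

open scoped Matrix.Norms.L2Operator in
theorem isCompact_stateSpace : IsCompact (StateSpace (Matrix n n ℂ)) := by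
  refine (WeakDual.isCompact_closedBall (𝕜 := ℂ) (E := Matrix n n ℂ) 0 4).of_isClosed_subset ?_ ?_
  · have : StateSpace (Matrix n n ℂ) =
        (⋂ a, {φ | 0 ≤ φ (star a * a)}) ∩ {φ : WeakDual ℂ (Matrix n n ℂ) | φ 1 = 1} := by
      ext φ; simp [StateSpace]
    rw [this]
    refine IsClosed.inter (isClosed_iInter fun a => ?_) ?_
    · exact isClosed_le continuous_const (WeakDual.eval_continuous _)
    · exact isClosed_eq (WeakDual.eval_continuous _) continuous_const
  · intro ω hω
    rw [Set.mem_preimage, mem_closedBall_zero_iff]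
    exact ContinuousLinearMap.opNorm_le_bound _ (by norm_num) fun A => norm_state_apply_le hω A

instance : CompactSpace (StateSpace (Matrix n n ℂ)) :=
  isCompact_iff_compactSpace.mp isCompact_stateSpace

instance [Nonempty n] : Nonempty (StateSpace (Matrix n n ℂ)) :=
  ⟨⟨_, gibbsDensity_mem Matrix.isHermitian_zero⟩⟩

end Compactness

/-! ### Approximating the entropy by finitely many linear functionals. -/

section EntropyNet

variable {n : Type*} [Fintype n] [DecidableEq n]

/-- The entropy is approximated by the energies of normalized exponentials. -/
theorem exists_neg_re_lt_entropy (ω : StateSpace (Matrix n n ℂ)) {ε : ℝ} (hε : 0 < ε) :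
    ∃ κ : Matrix n n ℂ, κ.IsHermitian ∧ (NormedSpace.exp κ).trace = 1 ∧
      -(ω.1 κ).re < vonNeumannEntropy (densityMatrix ω.1) + ε := by
  have hρ := densityMatrix_posSemidef ω.2
  have htr := densityMatrix_trace ω.2
  have hω := apply_eq_trace ω.1
  set ρ := densityMatrix ω.1
  obtain ⟨U, hU, h⟩ := IsHermitian.exists_conj_diagonal hρ.1
  have hS : vonNeumannEntropy ρ = ∑ i, Real.negMulLog (hρ.1.eigenvalues i) := by
    rw [vonNeumannEntropy, trace_cfc hρ.1, Complex.ofReal_re]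
  have hd0 := hρ.eigenvalues_nonneg
  have hd : ∑ i, hρ.1.eigenvalues i = 1 := by
    rw [hρ.1.trace_eq_sum_eigenvalues] at htr
    exact Complex.ofReal_injective (by simpa using htr)
  set d := hρ.1.eigenvalues
  obtain ⟨c, hcard⟩ : ∃ c : ℝ, c = Fintype.card n := ⟨_, rfl⟩
  -- The exponent is `log ((ρ + δ) / Z)` with `Z = Tr (ρ + δ)`: the shift makes the logarithm
  -- finite, and the normalisation costs `log Z ≤ c δ < ε`.
  set δ : ℝ := ε / (c + 1)
  have hc : 0 ≤ c := hcard ▸ Nat.cast_nonneg _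
  have hδ : 0 < δ := by positivity
  set Z : ℝ := 1 + c * δ
  have hZ : 0 < Z := by positivity
  set g : ℝ → ℝ := fun x => Real.log (x + δ) - Real.log Z
  have hκ : (U * Matrix.diagonal (fun i => ((g (d i) : ℝ) : ℂ)) * star U).IsHermitian := by
    rw [Matrix.star_eq_conjTranspose]
    refine Matrix.isHermitian_mul_mul_conjTranspose _ ?_
    exact Matrix.isHermitian_diagonal_of_self_adjoint _ (by ext i; simp)
  refine ⟨_, hκ, ?_, ?_⟩
  · rw [← cfc_real_exp hκ, cfc_conj_diagonal hU (fun i => g (d i)), trace_conj_diagonal hU]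
    have : ∀ i, Real.exp (g (d i)) = (d i + δ) / Z := fun i => by
      have : 0 < d i + δ := add_pos_of_nonneg_of_pos (hd0 i) hδ
      simp only [g]
      rw [Real.exp_sub, Real.exp_log this, Real.exp_log hZ]
    simp only [this]
    rw [← Complex.ofReal_sum, ← Finset.sum_div, Finset.sum_add_distrib, hd]
    simp only [Finset.sum_const, Finset.card_univ, nsmul_eq_mul, ← hcard]
    exact_mod_cast div_self hZ.ne'
  · rw [hω]
    have e : ρ * (U * Matrix.diagonal (fun i => ((g (d i) : ℝ) : ℂ)) * star U) =
        U * Matrix.diagonal (fun i => ((d i * g (d i) : ℝ) : ℂ)) * star U := by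
      calc _ = U * Matrix.diagonal (fun i => (d i : ℂ)) * (star U * U) *
            Matrix.diagonal (fun i => ((g (d i) : ℝ) : ℂ)) * star U := by
              conv_lhs => rw [h]
              simp only [mul_assoc]
        _ = _ := by
          rw [mul_eq_one_comm.mp hU, mul_one, mul_assoc U, Matrix.diagonal_mul_diagonal]
          simp
    rw [e, trace_conj_diagonal hU, ← Complex.ofReal_sum, Complex.ofReal_re, hS]
    have h1 : ∀ i, -(d i * g (d i)) ≤ Real.negMulLog (d i) + d i * (c * δ) := by
      intro i
      rcases (hd0 i).eq_or_lt with h0 | h0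
      · rw [← h0]; simp
      · have hl : Real.log (d i) ≤ Real.log (d i + δ) := Real.log_le_log h0 (by linarith)
        have hlZ : Real.log Z ≤ c * δ := by
          have := Real.log_le_sub_one_of_pos hZ
          simpa [Z] using this
        simp only [g, Real.negMulLog]
        nlinarith
    have h2 : c * δ < ε := by
      have : c * δ = ε * (c / (c + 1)) := by simp only [δ]; ring
      rw [this]
      exact mul_lt_of_lt_one_right hε ((div_lt_one (by positivity)).mpr (by linarith))
    calc -∑ i, d i * g (d i) = ∑ i, -(d i * g (d i)) := by rw [Finset.sum_neg_distrib]
      _ ≤ ∑ i, (Real.negMulLog (d i) + d i * (c * δ)) := Finset.sum_le_sum fun i _ => h1 i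
      _ = ∑ i, Real.negMulLog (d i) + c * δ := by
        rw [Finset.sum_add_distrib, ← Finset.sum_mul, hd, one_mul]
      _ < _ := by linarith

/-- For fixed `κ` the strict inequality is an open condition on `ω`, so finitely many `κ` cover the
compact state space. Since always `S(ω) ≤ -ω(κ)` by the Gibbs inequality, the entropy is, up to `ε`,
a minimum of finitely many linear functionals. -/
theorem exists_entropy_net {ε : ℝ} (hε : 0 < ε) :
    ∃ s : Finset (Matrix n n ℂ),
      (∀ κ ∈ s, κ.IsHermitian ∧ (NormedSpace.exp κ).trace = 1) ∧
      ∀ ω : StateSpace (Matrix n n ℂ), ∃ κ ∈ s,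
        -(ω.1 κ).re < vonNeumannEntropy (densityMatrix ω.1) + ε := by
  classical
  choose κ hκ htr hlt using fun ω : StateSpace (Matrix n n ℂ) => exists_neg_re_lt_entropy ω hε
  obtain ⟨t, ht⟩ := isCompact_univ.elim_finite_subcover
    (fun ω : StateSpace (Matrix n n ℂ) =>
      {ω' : StateSpace (Matrix n n ℂ) |
        -(ω'.1 (κ ω)).re < vonNeumannEntropy (densityMatrix ω'.1) + ε})
    (fun ω => isOpen_lt
      (Complex.continuous_re.comp
        ((WeakDual.eval_continuous (κ ω)).comp continuous_subtype_val)).neg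
      (continuous_entropy.add continuous_const))
    (fun ω _ => Set.mem_iUnion.mpr ⟨ω, hlt ω⟩)
  refine ⟨t.image κ, ?_, fun ω => ?_⟩
  · intro x hx
    obtain ⟨ω, -, rfl⟩ := Finset.mem_image.mp hx
    exact ⟨hκ ω, htr ω⟩
  · have := ht (Set.mem_univ ω)
    simp only [Set.mem_iUnion] at this
    obtain ⟨ω', hω', h⟩ := this
    exact ⟨κ ω', Finset.mem_image_of_mem _ hω', h⟩

end EntropyNet

/-! ### Merging the finite family into one normalised observable. -/

section Mixtures

open scoped MatrixOrder Matrix.Norms.L2Operator in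
/-- The logarithm of a uniform mixture of exponentials dominates each exponent up to a constant. -/
theorem exists_log_mixture {n ι : Type*} [Fintype n] [DecidableEq n] {s : Finset ι}
    (hs : s.Nonempty) {B : ι → Matrix n n ℂ} (hB : ∀ j ∈ s, (B j).IsHermitian) :
    ∃ K : Matrix n n ℂ, K.IsHermitian ∧
      NormedSpace.exp K = (s.card : ℝ)⁻¹ • ∑ j ∈ s, NormedSpace.exp (B j) ∧
      ∀ j ∈ s, B j - algebraMap ℝ (Matrix n n ℂ) (Real.log s.card) ≤ K := by
  have hJ : (0 : ℝ) < s.card := by exact_mod_cast hs.card_pos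
  have hexp : ∀ j ∈ s, IsStrictlyPositive (NormedSpace.exp (B j)) := fun j hj =>
    IsStrictlyPositive.iff_of_unital.mpr ⟨IsSelfAdjoint.exp_nonneg (hB j hj), Matrix.isUnit_exp _⟩
  set σ := (s.card : ℝ)⁻¹ • ∑ j ∈ s, NormedSpace.exp (B j) with hσ
  have hle : ∀ j ∈ s, (s.card : ℝ)⁻¹ • NormedSpace.exp (B j) ≤ σ := fun j hj =>
    smul_le_smul_of_nonneg_left
      (Finset.single_le_sum (fun i hi => (hexp i hi).nonneg) hj) (inv_nonneg.mpr hJ.le)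
  have hpos : ∀ j ∈ s, IsStrictlyPositive ((s.card : ℝ)⁻¹ • NormedSpace.exp (B j)) :=
    fun j hj => (hexp j hj).smul (inv_pos.mpr hJ)
  obtain ⟨j₀, hj₀⟩ := hs
  have hσpos : IsStrictlyPositive σ := (hpos j₀ hj₀).of_le (hle j₀ hj₀)
  refine ⟨CFC.log σ, IsSelfAdjoint.log, CFC.exp_log σ hσpos, fun j hj => ?_⟩
  -- Each term of the mixture is below the mixture, and the logarithm is operator monotone.
  have h1 := CFC.log_le_log (hle j hj) (hpos j hj)
  rw [CFC.log_smul' _ (inv_pos.mpr hJ) (hexp j hj), CFC.log_exp _ (hB j hj), Real.log_inv,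
    map_neg, neg_add_eq_sub] at h1
  exact h1

theorem trace_exp_elemTensor_one (κ : Matrix (Fin k) (Fin k) ℂ) :
    (NormedSpace.exp (elemTensor fun _ : Fin 1 => κ)).trace = (NormedSpace.exp κ).trace := by
  have : (elemTensor fun _ : Fin 1 => κ) =
      (Matrix.reindexAlgEquiv ℂ ℂ (Equiv.funUnique (Fin 1) (Fin k)).symm).toAlgHom κ := by
    ext f g
    simp [elemTensor]
  rw [this, ← algHom_exp]
  exact trace_reindexAlgEquiv _ _

open scoped MatrixOrder in
/-- A normalized `m`-body observable whose values on product states approximate the maximum of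
the one-body energies in a finite family. -/
theorem exists_mixture {s : Finset (Matrix (Fin k) (Fin k) ℂ)} (hs : s.Nonempty)
    (hκ : ∀ κ ∈ s, κ.IsHermitian ∧ (NormedSpace.exp κ).trace = 1) (m : ℕ) :
    ∃ K : TensorPow k m, K.IsHermitian ∧ (NormedSpace.exp K).trace = 1 ∧
      ∀ ω : StateSpace (Matrix (Fin k) (Fin k) ℂ), ∀ κ ∈ s,
        m * (ω.1 κ).re - Real.log s.card ≤ (productFunctional ω.1 m K).re := by
  have hB : ∀ κ : Matrix (Fin k) (Fin k) ℂ, ∃ B : TensorPow k m, κ ∈ s →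
      B.IsHermitian ∧ (NormedSpace.exp B).trace = 1 ∧
        ∀ ω : StateSpace (Matrix (Fin k) (Fin k) ℂ),
          productFunctional ω.1 m B = m * ω.1 κ := by
    intro κ
    by_cases h : κ ∈ s
    · have hh : (elemTensor fun _ : Fin 1 => κ).IsHermitian := by
        rw [Matrix.IsHermitian, ← Matrix.star_eq_conjTranspose, star_elemTensor,
          Matrix.star_eq_conjTranspose, (hκ κ h).1.eq]
      -- Blocks of a single site: `B` is the sum of `κ` over all `m` sites.
      obtain ⟨B, hB, htr, hφ⟩ := exists_blockSum hh 0 m m (by simp)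
      refine ⟨B, fun _ => ⟨hB, ?_, fun ω => ?_⟩⟩
      · rw [htr, trace_exp_elemTensor_one, (hκ κ h).2]; simp
      · refine hφ _ (productFunctional_isPermInvariant ω.1 m) _ fun hm => ?_
        rw [productFunctional_embed ω.2.2, productFunctional_elemTensor]
        simp
    · exact ⟨0, fun h' => absurd h' h⟩
  choose B hB using hB
  obtain ⟨K, hK, hexp, hle⟩ := exists_log_mixture hs fun κ h => (hB κ h).1
  have hJ : (s.card : ℝ) ≠ 0 := by exact_mod_cast hs.card_pos.ne'
  refine ⟨K, hK, ?_, fun ω κ h => ?_⟩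
  · rw [hexp, Matrix.trace_smul, Matrix.trace_sum, Finset.sum_congr rfl fun κ h => (hB κ h).2.1]
    simp only [Finset.sum_const, nsmul_eq_mul, mul_one, Complex.real_smul]
    rw [Complex.ofReal_inv, Complex.ofReal_natCast]
    exact inv_mul_cancel₀ (by exact_mod_cast hJ)
  · have h1 := state_re_mono (productState ω m).2 (hle κ h)
    have e : algebraMap ℝ (TensorPow k m) (Real.log s.card) = ((Real.log s.card : ℝ) : ℂ) • 1 := by
      rw [Algebra.algebraMap_eq_smul_one]; ext i j; simp [Matrix.one_apply]
    rw [e, map_sub, map_smul, (productState ω m).2.2, productState_apply, productState_apply,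
      (hB κ h).2.2, Complex.sub_re, ← Complex.ofReal_natCast m, Complex.re_ofReal_mul, smul_eq_mul,
      mul_one, Complex.ofReal_re] at h1
    exact h1

end Mixtures

/-! ### Permutation invariance of Gibbs states. -/

section GibbsStates

theorem permute_exp {N : ℕ} (π : Equiv.Perm (Fin N)) (A : TensorPow k N) :
    permute π (NormedSpace.exp A) = NormedSpace.exp (permute π A) := by
  rw [permute_eq_reindex, permute_eq_reindex]
  exact algHom_exp (Matrix.reindexAlgEquiv ℂ ℂ (Equiv.arrowCongr π (Equiv.refl (Fin k)))).toAlgHom A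

theorem permute_mul {N : ℕ} (π : Equiv.Perm (Fin N)) (A B : TensorPow k N) :
    permute π (A * B) = permute π A * permute π B := by
  simp only [permute_eq_reindex, map_mul]

theorem trace_permute {N : ℕ} (π : Equiv.Perm (Fin N)) (A : TensorPow k N) :
    (permute π A).trace = A.trace := by
  rw [permute_eq_reindex, trace_reindexAlgEquiv]

theorem gibbs_isPermInvariant {N : ℕ} {K : TensorPow k N}
    (hK : ∀ π : Equiv.Perm (Fin N), permute π K = K) :
    IsPermInvariant (traceFunctional (gibbsDensity K)).toLinearMap := by
  intro π A
  change (gibbsDensity K * permute π A).trace = (gibbsDensity K * A).trace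
  have : permute π (gibbsDensity K) = gibbsDensity K := by
    rw [gibbsDensity, map_smul, permute_exp, hK]
  rw [← trace_permute π (gibbsDensity K * A), permute_mul, this]

end GibbsStates

/-! ### The local free energy as a minimum: the Gibbs principle with exponent `-βA`. -/

section LocalFreeEnergy

variable {N : ℕ} {β : ℝ}

theorem isHermitian_real_smul {n : Type*} {A : Matrix n n ℂ} (hA : A.IsHermitian) (r : ℝ) :
    ((r : ℂ) • A).IsHermitian := by
  rw [Matrix.IsHermitian, Matrix.conjTranspose_smul, hA.eq]
  simp

theorem isHermitian_neg_smul {A : TensorPow k N} (hA : A.IsHermitian) :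
    (-(β : ℂ) • A).IsHermitian := by
  simpa using isHermitian_real_smul hA (-β)

theorem localFreeEnergy_le [NeZero k] (hβ : 0 < β) {A : TensorPow k N} (hA : A.IsHermitian)
    (ω : StateSpace (TensorPow k N)) : localFreeEnergy β A ≤ localFreeEnergyAt β A ω := by
  have h := re_add_entropy_le_log_trace_exp ω.2 (isHermitian_neg_smul (β := β) hA)
  rw [map_smul, smul_eq_mul, ← Complex.ofReal_neg, Complex.re_ofReal_mul] at h
  have h2 := mul_le_mul_of_nonneg_left h (inv_nonneg.mpr hβ.le)
  have h3 : β⁻¹ * (-β * (ω.1 A).re) = -(ω.1 A).re := by field_simp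
  rw [mul_add, h3] at h2
  unfold localFreeEnergy localFreeEnergyAt
  push_cast at h2
  linarith

/-- The Gibbs state of `A` at inverse temperature `β`. -/
noncomputable def gibbsState [NeZero k] (β : ℝ) {A : TensorPow k N} (hA : A.IsHermitian) :
    StateSpace (TensorPow k N) :=
  ⟨_, gibbsDensity_mem (isHermitian_neg_smul (β := β) hA)⟩

theorem localFreeEnergyAt_gibbsState [NeZero k] (hβ : 0 < β) {A : TensorPow k N}
    (hA : A.IsHermitian) :
    localFreeEnergyAt β A (gibbsState β hA) = localFreeEnergy β A := by
  have h := gibbs_re_add_entropy (isHermitian_neg_smul (β := β) hA)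
  unfold localFreeEnergy localFreeEnergyAt
  change ((traceFunctional (gibbsDensity _)) A).re -
    β⁻¹ * vonNeumannEntropy (densityMatrix (traceFunctional (gibbsDensity _))) = _
  rw [densityMatrix_traceFunctional, ← h, map_smul, smul_eq_mul, ← Complex.ofReal_neg,
    Complex.re_ofReal_mul]
  field_simp
  ring

theorem isGLB_localFreeEnergy [NeZero k] (hβ : 0 < β) {A : TensorPow k N} (hA : A.IsHermitian) :
    IsGLB (Set.range fun ω : StateSpace (TensorPow k N) => localFreeEnergyAt β A ω)
      (localFreeEnergy β A) := by
  refine IsLeast.isGLB ⟨⟨gibbsState β hA, localFreeEnergyAt_gibbsState hβ hA⟩, ?_⟩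
  rintro _ ⟨ω, rfl⟩
  exact localFreeEnergy_le hβ hA ω

end LocalFreeEnergy

/-! ### Few-body approximation and the limit function. -/

section Approximation

theorem embed_conjTranspose {M N : ℕ} (h : M ≤ N) (A : TensorPow k M) :
    (embed h A).conjTranspose = embed h A.conjTranspose := by
  ext f g
  simp only [embed, Matrix.conjTranspose_apply, Matrix.of_apply]
  have : (∀ i : Fin N, M ≤ i.1 → g i = f i) ↔ ∀ i : Fin N, M ≤ i.1 → f i = g i :=
    ⟨fun h i hi => (h i hi).symm, fun h i hi => (h i hi).symm⟩
  simp only [this]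
  split_ifs <;> simp

theorem symmetrizer_conjTranspose {N : ℕ} (A : TensorPow k N) :
    (symmetrizer N A).conjTranspose = symmetrizer N A.conjTranspose := by
  rw [symmetrizer_eq_sum_permute, symmetrizer_eq_sum_permute, Matrix.conjTranspose_smul,
    Matrix.conjTranspose_sum]
  simp only [star_inv₀, star_natCast]
  rfl

/-- The symmetrizer as a linear map. -/
noncomputable def symmetrizerₗ (N : ℕ) : TensorPow k N →ₗ[ℂ] TensorPow k N :=
  ((N.factorial : ℂ)⁻¹) • ∑ π : Equiv.Perm (Fin N), permute π

theorem symmetrizerₗ_apply {N : ℕ} (A : TensorPow k N) : symmetrizerₗ N A = symmetrizer N A := by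
  rw [symmetrizer_eq_sum_permute]
  simp [symmetrizerₗ]

open scoped Matrix.Norms.L2Operator in
/-- The `m`-body observable `a` approximates the sequence `H` in norm up to `ε`. -/
def Approximates (H : ∀ N : ℕ, TensorPow k N) {M : ℕ} (a : TensorPow k M) (ε : ℝ) : Prop :=
  ∃ N₀ : ℕ, ∀ (N : ℕ) (h : M ≤ N), N₀ ≤ N → ‖H N - symmetrizer N (embed h a)‖ ≤ ε

-- The given approximant need not be Hermitian; its Hermitian part is at least as good, because
-- taking Hermitian parts is contractive, fixes `H N` and commutes with embedding and symmetrizing.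
open scoped Matrix.Norms.L2Operator in
theorem IsQuasiSymmetric.exists_approximates {H : ∀ N : ℕ, TensorPow k N}
    (hH : IsQuasiSymmetric H) (hHerm : ∀ N : ℕ, 1 ≤ N → (H N).IsHermitian) {ε : ℝ} (hε : 0 < ε) :
    ∃ (M : ℕ) (a : TensorPow k M), a.IsHermitian ∧ Approximates H a ε := by
  obtain ⟨A, ⟨M, -, a, hA⟩, N₀, hN₀⟩ := hH.2 ε hε
  have hre : ∀ {n : Type} [Fintype n] [DecidableEq n] (X : Matrix n n ℂ),
      ((2⁻¹ : ℂ) • (X + X.conjTranspose)).IsHermitian := fun X => by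
    rw [Matrix.IsHermitian, Matrix.conjTranspose_smul, Matrix.conjTranspose_add,
      Matrix.conjTranspose_conjTranspose, add_comm]
    simp
  refine ⟨M, (2⁻¹ : ℂ) • (a + a.conjTranspose), hre a, N₀ + 1, fun N h hN => ?_⟩
  have h1 := (hN₀ N (by omega)).le
  have hHN := hHerm N (by omega)
  rw [hA N h] at h1
  set X := symmetrizer N (embed h a) with hX
  have e : symmetrizer N (embed h ((2⁻¹ : ℂ) • (a + a.conjTranspose))) =
      (2⁻¹ : ℂ) • (X + X.conjTranspose) := by
    rw [hX, symmetrizer_conjTranspose, embed_conjTranspose]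
    simp only [← symmetrizerₗ_apply, ← embedₗ_apply, map_smul, map_add]
  have e2 : H N - (2⁻¹ : ℂ) • (X + X.conjTranspose) =
      (2⁻¹ : ℂ) • ((H N - X) + (H N - X).conjTranspose) := by
    rw [Matrix.conjTranspose_sub, hHN.eq]
    module
  rw [e, e2, norm_smul]
  have h3 : ‖(H N - X).conjTranspose‖ = ‖H N - X‖ := Matrix.l2_opNorm_conjTranspose _
  have h4 := norm_add_le (H N - X) (H N - X).conjTranspose
  have h5 : ‖(2⁻¹ : ℂ)‖ = 2⁻¹ := by simp
  rw [h5]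
  linarith

-- Invariant states do not see the symmetrizer, so the norm bound compares `H N` with the bare
-- `embed hM a`, uniformly in the state.
open scoped Matrix.Norms.L2Operator in
theorem Approximates.abs_re_sub_le {H : ∀ N : ℕ, TensorPow k N}
    (hHerm : ∀ N : ℕ, 1 ≤ N → (H N).IsHermitian) {M : ℕ} {a : TensorPow k M}
    (ha : a.IsHermitian) {ε : ℝ} (h : Approximates H a ε) :
    ∃ N₀ : ℕ, ∀ (N : ℕ) (hM : M ≤ N), N₀ ≤ N → ∀ ω : WeakDual ℂ (TensorPow k N),
      ω ∈ StateSpace (TensorPow k N) → IsPermInvariant ω.toLinearMap →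
        |(ω (H N)).re - (ω (embed hM a)).re| ≤ ε := by
  obtain ⟨N₀, h⟩ := h
  refine ⟨N₀ + 1, fun N hM hN ω hω hinv => ?_⟩
  have h1 := abs_state_re_le hω
    ((hHerm N (by omega)).sub (symmetrizer_isHermitian (embed_isHermitian hM ha)))
  have h2 : ω (symmetrizer N (embed hM a)) = ω (embed hM a) := hinv.symmetrizer _
  rw [map_sub, h2, Complex.sub_re] at h1
  exact h1.trans (h N hM (by omega))

theorem productState_isPermInvariant (ω : StateSpace (Matrix (Fin k) (Fin k) ℂ)) (N : ℕ) :
    IsPermInvariant (productState ω N).1.toLinearMap := by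
  intro π A
  have := productFunctional_isPermInvariant ω.1 N π A
  rwa [← productState_apply, ← productState_apply] at this

theorem continuous_productFunctional {M : ℕ} (a : TensorPow k M) :
    Continuous fun ω : StateSpace (Matrix (Fin k) (Fin k) ℂ) =>
      (productFunctional ω.1 M a).re := by
  refine Complex.continuous_re.comp ?_
  change Continuous fun ω : StateSpace (Matrix (Fin k) (Fin k) ℂ) =>
    ∑ f, ∑ g, a f g * ∏ i, ω.1 (Matrix.single (f i) (g i) 1)
  refine continuous_finsetSum _ fun f _ => continuous_finsetSum _ fun g _ =>
    continuous_const.mul (continuous_finsetProd _ fun i _ => ?_)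
  exact (WeakDual.eval_continuous _).comp continuous_subtype_val

/-- The limit of the mean-field Hamiltonians on product states. -/
theorem exists_meanFieldLimit {H : ∀ N : ℕ, TensorPow k N} (hH : IsQuasiSymmetric H)
    (hHerm : ∀ N : ℕ, 1 ≤ N → (H N).IsHermitian) :
    ∃ h₀ : C(StateSpace (Matrix (Fin k) (Fin k) ℂ), ℝ),
      (∀ ω : StateSpace (Matrix (Fin k) (Fin k) ℂ),
        Tendsto (fun N : ℕ => (productFunctional ω.1 N (H N)).re) atTop (𝓝 (h₀ ω))) ∧
      ∀ (M : ℕ) (a : TensorPow k M) (ε : ℝ), a.IsHermitian → Approximates H a ε →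
        ∀ ω : StateSpace (Matrix (Fin k) (Fin k) ℂ),
          |h₀ ω - (productFunctional ω.1 M a).re| ≤ ε := by
  -- `N₀` does not depend on `ω`. This gives the Cauchy property and also continuity of the limit,
  -- as a uniform limit of the continuous functions `productFunctional · M a`.
  have key : ∀ (M : ℕ) (a : TensorPow k M) (ε : ℝ), a.IsHermitian → Approximates H a ε →
      ∃ N₀, ∀ N, N₀ ≤ N → ∀ ω : StateSpace (Matrix (Fin k) (Fin k) ℂ),
        |(productFunctional ω.1 N (H N)).re - (productFunctional ω.1 M a).re| ≤ ε := by
    intro M a ε ha h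
    obtain ⟨N₀, h⟩ := h.abs_re_sub_le hHerm ha
    refine ⟨max N₀ M, fun N hN ω => ?_⟩
    have hM : M ≤ N := (le_max_right _ _).trans hN
    have := h N hM ((le_max_left _ _).trans hN) _ (productState ω N).2
      (productState_isPermInvariant ω N)
    rwa [productState_apply, productState_apply, productFunctional_embed ω.2.2] at this
  have hlim : ∀ ω : StateSpace (Matrix (Fin k) (Fin k) ℂ), ∃ x,
      Tendsto (fun N : ℕ => (productFunctional ω.1 N (H N)).re) atTop (𝓝 x) := by
    intro ω
    refine cauchySeq_tendsto_of_complete (Metric.cauchySeq_iff'.mpr fun ε hε => ?_)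
    obtain ⟨M, a, ha, happ⟩ := hH.exists_approximates hHerm (show 0 < ε / 3 by positivity)
    obtain ⟨N₀, h⟩ := key M a _ ha happ
    refine ⟨N₀, fun N hN => ?_⟩
    have h1 := abs_le.mp (h N hN ω)
    have h2 := abs_le.mp (h N₀ le_rfl ω)
    rw [Real.dist_eq, abs_lt]
    constructor <;> linarith [h1.1, h1.2, h2.1, h2.2]
  choose h₀ hh₀ using hlim
  have hclose : ∀ (M : ℕ) (a : TensorPow k M) (ε : ℝ), a.IsHermitian → Approximates H a ε →
      ∀ ω : StateSpace (Matrix (Fin k) (Fin k) ℂ),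
        |h₀ ω - (productFunctional ω.1 M a).re| ≤ ε := by
    intro M a ε ha happ ω
    obtain ⟨N₀, h⟩ := key M a _ ha happ
    exact le_of_tendsto ((hh₀ ω).sub_const _).abs
      ((eventually_ge_atTop N₀).mono fun N hN => h N hN ω)
  refine ⟨⟨h₀, ?_⟩, hh₀, hclose⟩
  refine continuous_of_uniform_approx_of_continuous fun u hu => ?_
  obtain ⟨ε, hε, hεu⟩ := Metric.mem_uniformity_dist.mp hu
  obtain ⟨M, a, ha, happ⟩ := hH.exists_approximates hHerm (show 0 < ε / 2 by positivity)
  refine ⟨_, continuous_productFunctional a, fun ω => hεu ?_⟩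
  rw [Real.dist_eq]
  exact (hclose M a _ ha happ ω).trans_lt (by linarith)

end Approximation

/-! ### The thermodynamic limit of the free energy. -/

section FreeEnergyLimit

variable {β : ℝ} {H : ∀ N : ℕ, TensorPow k N}

theorem isHermitian_natCast_smul {N : ℕ} {A : TensorPow k N} (hA : A.IsHermitian) :
    ((N : ℂ) • A).IsHermitian := by
  simpa using isHermitian_real_smul hA N

/-- Expectations of an `m`-body observable are bounded uniformly in the number of sites. -/
theorem abs_re_embed_le {m : ℕ} {K : TensorPow k m} (hK : K.IsHermitian) :
    ∃ C : ℝ, 0 ≤ C ∧ ∀ (N : ℕ) (hm : m ≤ N) (ω : WeakDual ℂ (TensorPow k N)),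
      ω ∈ StateSpace (TensorPow k N) → |(ω (embed hm K)).re| ≤ C := by
  open scoped Matrix.Norms.L2Operator in
  refine ⟨‖K‖, norm_nonneg _, fun N hm ω hω => ?_⟩
  obtain ⟨d, rfl⟩ := Nat.exists_eq_add_of_le hm
  -- The restriction of `ω` to the first `m` sites is again a state, so `‖K‖` itself bounds the
  -- expectation.
  let ω₀ : TensorPow k m →ₗ[ℂ] ℂ := ω.toLinearMap.comp (tensorLeft m d).toLinearMap
  let ω' : WeakDual ℂ (TensorPow k m) :=
    StrongDual.toWeakDual ⟨ω₀, LinearMap.continuous_of_finiteDimensional ω₀⟩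
  have hω' : ω' ∈ StateSpace (TensorPow k m) := by
    refine ⟨fun a => ?_, ?_⟩
    · change 0 ≤ ω (tensorLeft m d (star a * a))
      have : tensorLeft m d (star a) = star (tensorLeft m d a) := by
        rw [tensorLeft_eq_embed, tensorLeft_eq_embed, Matrix.star_eq_conjTranspose,
          Matrix.star_eq_conjTranspose, embed_conjTranspose]
      rw [map_mul, this]
      exact hω.1 _
    · change ω (tensorLeft m d 1) = 1
      rw [map_one, hω.2]
  have := abs_state_re_le hω' hK
  rwa [← tensorLeft_eq_embed]

/-- Upper bound on the free energy per site by product states. -/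
theorem freeEnergy_le_product [NeZero k] (hβ : 0 < β) {N : ℕ} (hN : 1 ≤ N) {A : TensorPow k N}
    (hA : A.IsHermitian) (ω : StateSpace (Matrix (Fin k) (Fin k) ℂ)) :
    1 / (N : ℝ) * localFreeEnergy β ((N : ℂ) • A) ≤
      (productFunctional ω.1 N A).re - β⁻¹ * vonNeumannEntropy (densityMatrix ω.1) := by
  have hN' : (0 : ℝ) < N := by exact_mod_cast hN
  have h := localFreeEnergy_le hβ (isHermitian_natCast_smul hA) (productState ω N)
  rw [localFreeEnergyAt, entropy_productState, map_smul, productState_apply, smul_eq_mul,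
    ← Complex.ofReal_natCast, Complex.re_ofReal_mul] at h
  rw [one_div, inv_mul_le_iff₀ hN', ← Complex.ofReal_natCast]
  linarith

/-- Lower bound on the free energy of a permutation invariant Hamiltonian by block observables. -/
theorem exists_le_freeEnergy [NeZero k] (hβ : 0 < β) {N : ℕ} {A : TensorPow k N}
    (hA : A.IsHermitian) (hAinv : ∀ π : Equiv.Perm (Fin N), permute π A = A)
    {m : ℕ} (hm : m ≤ N) {K : TensorPow k m} (hK : K.IsHermitian)
    (htr : (NormedSpace.exp K).trace = 1) :
    ∃ ω : StateSpace (TensorPow k N), IsPermInvariant ω.1.toLinearMap ∧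
      N * (ω.1 A).re + β⁻¹ * ((N / m : ℕ) * (ω.1 (embed hm K)).re - (N % m : ℕ) * Real.log k) ≤
        localFreeEnergy β ((N : ℂ) • A) := by
  have hNA := isHermitian_natCast_smul hA
  have hinv : IsPermInvariant (gibbsState β hNA).1.toLinearMap :=
    gibbs_isPermInvariant fun π => by rw [map_smul, map_smul, hAinv]
  refine ⟨gibbsState β hNA, hinv, ?_⟩
  rw [← localFreeEnergyAt_gibbsState hβ hNA]
  set ω := gibbsState β hNA
  -- With `q = N / m` and `r = N % m`, the Gibbs inequality for the trial exponent `B` bounds the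
  -- entropy of the Gibbs state by `r log k - q ω(K)`.
  obtain ⟨B, hB, hBtr, hφ⟩ := exists_blockSum hK (N % m) (N / m) N (Nat.div_add_mod' N m).symm
  have h1 : ω.1 B = (N / m : ℕ) * ω.1 (embed hm K) := hφ _ hinv _ fun _ => rfl
  have h2 := re_add_entropy_le_log_trace_exp ω.2 hB
  rw [h1, hBtr, htr, one_pow, one_mul, ← Complex.ofReal_natCast, Complex.re_ofReal_mul,
    ← Complex.ofReal_natCast, ← Complex.ofReal_pow, Complex.ofReal_re, Real.log_pow] at h2
  rw [localFreeEnergyAt, map_smul, smul_eq_mul, ← Complex.ofReal_natCast N, Complex.re_ofReal_mul]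
  have h3 := mul_le_mul_of_nonneg_left h2 (inv_nonneg.mpr hβ.le)
  rw [mul_add] at h3
  rw [mul_sub]
  linarith

/-- The loss `(4 + 2β⁻¹) ε` collects `ε` each from `h₀` versus `a` on product states, de Finetti, `H
N` versus `a`, and the incomplete block, and `β⁻¹ ε` each from the entropy net and from `log
s.card`. -/
theorem eventually_le_freeEnergy [NeZero k] (hβ : 0 < β) (hH : IsQuasiSymmetric H)
    (hHerm : ∀ N : ℕ, 1 ≤ N → (H N).IsHermitian)
    {h₀ : StateSpace (Matrix (Fin k) (Fin k) ℂ) → ℝ}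
    (hh₀ : ∀ (M : ℕ) (a : TensorPow k M) (ε : ℝ), a.IsHermitian → Approximates H a ε →
        ∀ ω : StateSpace (Matrix (Fin k) (Fin k) ℂ),
          |h₀ ω - (productFunctional ω.1 M a).re| ≤ ε)
    {F : ℝ} (hF : ∀ ω, F ≤ h₀ ω - β⁻¹ * vonNeumannEntropy (densityMatrix ω.1))
    {ε : ℝ} (hε : 0 < ε) :
    ∀ᶠ N : ℕ in atTop, F - (4 + 2 * β⁻¹) * ε ≤ 1 / (N : ℝ) * localFreeEnergy β ((N : ℂ) • H N) := by
  have hβ' : 0 < β⁻¹ := inv_pos.mpr hβ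
  obtain ⟨M, a, ha, happ⟩ := hH.exists_approximates hHerm hε
  obtain ⟨s, hs, hnet⟩ := exists_entropy_net (n := Fin k) hε
  have hsne : s.Nonempty := by
    obtain ⟨κ, hκ, -⟩ := hnet (Classical.arbitrary _)
    exact ⟨κ, hκ⟩
  -- The block is large enough that the mixture constant costs at most `ε` per site.
  obtain ⟨m₀, hm₀⟩ := exists_nat_gt (Real.log s.card / ε)
  set m := max (max M m₀) 1
  have hMm : M ≤ m := (le_max_left _ _).trans (le_max_left _ _)
  have hm1 : 1 ≤ m := le_max_right _ _
  have hm0 : (0 : ℝ) < m := by exact_mod_cast hm1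
  have hlogm : Real.log s.card ≤ m * ε := by
    have : (m₀ : ℝ) ≤ m := by exact_mod_cast (le_max_right M m₀).trans (le_max_left _ 1)
    rw [div_lt_iff₀ hε] at hm₀
    nlinarith
  obtain ⟨K, hK, hKtr, hKs⟩ := exists_mixture hsne hs m
  -- On product states `K` is nearly at least `m ω(κ)`, so `t K` nearly dominates `-β⁻¹ S(ω)`, and
  -- `b` is an `m`-body stand-in for the free energy density.
  set t : ℝ := β⁻¹ / m with ht
  have ht0 : 0 < t := by positivity
  set b : TensorPow k m := embed hMm a + (t : ℂ) • K with hb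
  set c : ℝ := F - ε - 2 * β⁻¹ * ε with hc
  have hbc : ∀ ω : StateSpace (Matrix (Fin k) (Fin k) ℂ), c ≤ (productFunctional ω.1 m b).re := by
    intro ω
    obtain ⟨κ, hκ, hlt⟩ := hnet ω
    have h1 := (abs_le.mp (hh₀ M a ε ha happ ω)).2
    have h2 := mul_le_mul_of_nonneg_left (hKs ω κ hκ) ht0.le
    have h3 : t * (m * (ω.1 κ).re - Real.log s.card) =
        β⁻¹ * (ω.1 κ).re - t * Real.log s.card := by
      rw [ht]; field_simp
    have h4 : t * Real.log s.card ≤ β⁻¹ * ε := by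
      calc _ ≤ t * (m * ε) := mul_le_mul_of_nonneg_left hlogm ht0.le
        _ = _ := by rw [ht]; field_simp
    have h5 := hF ω
    have h6 := mul_lt_mul_of_pos_left hlt hβ'
    rw [hb, map_add, map_smul, productFunctional_embed ω.2.2, Complex.add_re, smul_eq_mul,
      Complex.re_ofReal_mul]
    linarith
  obtain ⟨N₁, hN₁⟩ := eventually_le_of_isPermInvariant hbc hε
  obtain ⟨N₂, hN₂⟩ := happ.abs_re_sub_le hHerm ha
  obtain ⟨C, hC, hCK⟩ := abs_re_embed_le hK
  have hk : 0 ≤ Real.log k := Real.log_natCast_nonneg k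
  -- Beyond `N₃` the contribution of the fewer than `m` leftover sites is at most `N ε`.
  obtain ⟨N₃, hN₃⟩ := exists_nat_gt (β⁻¹ * (C + m * Real.log k) / ε)
  filter_upwards [eventually_ge_atTop N₁, eventually_ge_atTop N₂, eventually_ge_atTop N₃,
    eventually_ge_atTop m] with N h1 h2 h3 hmN
  have hN0 : (0 : ℝ) < N := by exact_mod_cast hm1.trans hmN
  have hHN := hHerm N (hm1.trans hmN)
  obtain ⟨ω, hinv, hle⟩ := exists_le_freeEnergy hβ hHN
    (fun π => by rw [hH.1 N (hm1.trans hmN), permute_symmetrizer]) hmN hK hKtr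
  have e1 := hN₁ N h1 hmN ω.1 ω.2 hinv
  have e2 := (abs_le.mp (hN₂ N (hMm.trans hmN) h2 ω.1 ω.2 hinv)).1
  have e3 := abs_le.mp (hCK N hmN ω.1 ω.2)
  have e4 : (ω.1 (embed hmN b)).re =
      (ω.1 (embed (hMm.trans hmN) a)).re + t * (ω.1 (embed hmN K)).re := by
    rw [hb, ← embedₗ_apply, map_add, map_smul, embedₗ_apply, embedₗ_apply, embed_trans, map_add,
      map_smul, smul_eq_mul, Complex.add_re, Complex.re_ofReal_mul]
  have e5 : ((N / m : ℕ) : ℝ) * m + (N % m : ℕ) = N := by exact_mod_cast Nat.div_add_mod' N m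
  have e6 : ((N % m : ℕ) : ℝ) ≤ m := by exact_mod_cast (Nat.mod_lt N hm1).le
  have e7 : (0 : ℝ) ≤ (N % m : ℕ) := Nat.cast_nonneg _
  set x := (ω.1 (embed hmN K)).re
  set q : ℝ := ((N / m : ℕ) : ℝ)
  set r : ℝ := ((N % m : ℕ) : ℝ)
  have e8 : β⁻¹ * (C + m * Real.log k) ≤ N * ε := by
    have : (N₃ : ℝ) ≤ N := by exact_mod_cast h3
    rw [div_lt_iff₀ hε] at hN₃
    nlinarith
  -- The number `q` of full blocks differs from `N / m` by `r / m ≤ 1`.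
  have e9 : β⁻¹ * (q * x) ≥ N * (t * x) - β⁻¹ * C := by
    have hq : N * (t * x) = β⁻¹ * (q * x) + β⁻¹ * (r / m * x) := by
      rw [← e5, ht]; field_simp
    have hr1 : r / m ≤ 1 := (div_le_one hm0).mpr e6
    have hr0 : 0 ≤ r / m := by positivity
    have hrx : r / m * x ≤ C := by
      calc r / m * x ≤ r / m * C := mul_le_mul_of_nonneg_left e3.2 hr0
        _ ≤ 1 * C := mul_le_mul_of_nonneg_right hr1 hC
        _ = C := one_mul C
    have := mul_le_mul_of_nonneg_left hrx hβ'.le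
    linarith
  have e10 : β⁻¹ * (r * Real.log k) ≤ β⁻¹ * (m * Real.log k) :=
    mul_le_mul_of_nonneg_left (mul_le_mul_of_nonneg_right e6 hk) hβ'.le
  rw [one_div, ← div_eq_inv_mul, le_div_iff₀ hN0]
  rw [e4] at e1
  have e11 : c - 2 * ε ≤ (ω.1 (H N)).re + t * x := by linarith
  have e12 := mul_le_mul_of_nonneg_left e11 hN0.le
  rw [hc] at e12
  rw [mul_sub] at hle
  rw [mul_add] at e8 e12
  linarith

/-- A state of `C(X)` is bounded below by lower bounds of functions. -/
theorem le_state_apply {X : Type*} [TopologicalSpace X] (ω : StateSpace C(X, ℂ)) {f : C(X, ℝ)}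
    {c : ℝ} (hf : ∀ x, c ≤ f x) : c ≤ (ω.1 (f.realToRCLike ℂ)).re := by
  -- The square root exhibits `f - c` as `g* g`, on which states are nonnegative.
  let g : C(X, ℂ) := ⟨fun x => ((Real.sqrt (f x - c) : ℝ) : ℂ), by fun_prop⟩
  have hg : star g * g = f.realToRCLike ℂ - (c : ℂ) • 1 := by
    ext x
    change star ((Real.sqrt (f x - c) : ℝ) : ℂ) * ((Real.sqrt (f x - c) : ℝ) : ℂ) =
      ((f x : ℝ) : ℂ) - c * 1
    rw [Complex.star_def, Complex.conj_ofReal, ← Complex.ofReal_mul,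
      Real.mul_self_sqrt (sub_nonneg.mpr (hf x))]
    simp
  have h := (Complex.le_def.mp (ω.2.1 g)).1
  rw [hg, map_sub, map_smul, ω.2.2] at h
  simpa using h

theorem meanFieldFreeEnergyAt_eq (h₀ : C(StateSpace (Matrix (Fin k) (Fin k) ℂ), ℝ))
    (ω : StateSpace C(StateSpace (Matrix (Fin k) (Fin k) ℂ), ℂ)) :
    meanFieldFreeEnergyAt β h₀ ω = (ω.1 ((h₀ - β⁻¹ • s₀).realToRCLike ℂ)).re := by
  have : (h₀ - β⁻¹ • s₀).realToRCLike ℂ =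
      h₀.realToRCLike ℂ - ((β⁻¹ : ℝ) : ℂ) • s₀.realToRCLike ℂ := by
    ext x
    change (((h₀ x - β⁻¹ * s₀ x : ℝ)) : ℂ) = (h₀ x : ℂ) - ((β⁻¹ : ℝ) : ℂ) * (s₀ x : ℂ)
    push_cast
    rfl
  rw [this, map_sub, map_smul, smul_eq_mul, Complex.sub_re, Complex.re_ofReal_mul]
  rfl

theorem meanFieldFreeEnergyAt_pointState (h₀ : C(StateSpace (Matrix (Fin k) (Fin k) ℂ), ℝ))
    (ρ : StateSpace (Matrix (Fin k) (Fin k) ℂ)) :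
    meanFieldFreeEnergyAt β h₀ (pointState ρ) =
      h₀ ρ - β⁻¹ * vonNeumannEntropy (densityMatrix ρ.1) := by
  unfold meanFieldFreeEnergyAt
  rw [pointState_apply, pointState_apply]
  rfl

end FreeEnergyLimit

end MeanField

theorem theorem4p3 (k : ℕ) (hk : 1 ≤ k) (β : ℝ) (hβ : 0 < β)
    (H : ∀ N : ℕ, MeanField.TensorPow k N)
    (hH : MeanField.IsQuasiSymmetric H)
    (hHerm : ∀ N : ℕ, 1 ≤ N → (H N).IsHermitian) :
    ∃ h₀ : C(MeanField.StateSpace (Matrix (Fin k) (Fin k) ℂ), ℝ),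
      (∀ ω : MeanField.StateSpace (Matrix (Fin k) (Fin k) ℂ),
        Tendsto (fun N : ℕ => MeanField.productFunctional ω.1 N (H N)) atTop
          (𝓝 ((h₀ ω : ℝ) : ℂ))) ∧
      (∀ N : ℕ, 1 ≤ N →
        IsGLB (Set.range fun ω : MeanField.StateSpace (MeanField.TensorPow k N) =>
            MeanField.localFreeEnergyAt β ((N : ℂ) • H N) ω)
          (MeanField.localFreeEnergy β ((N : ℂ) • H N))) ∧
      ∃ F : ℝ,
        Tendsto (fun N : ℕ => (1 / (N : ℝ)) * MeanField.localFreeEnergy β ((N : ℂ) • H N)) atTop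
          (𝓝 F) ∧
        IsGLB (Set.range fun
            ω : MeanField.StateSpace C(MeanField.StateSpace (Matrix (Fin k) (Fin k) ℂ), ℂ) =>
          MeanField.meanFieldFreeEnergyAt β h₀ ω) F ∧
        IsGLB (Set.range fun ρ : MeanField.StateSpace (Matrix (Fin k) (Fin k) ℂ) =>
          MeanField.meanFieldFreeEnergyAt β h₀ (MeanField.pointState ρ)) F ∧
        IsGLB (Set.range fun ρ : MeanField.StateSpace (Matrix (Fin k) (Fin k) ℂ) =>
          h₀ ρ - β⁻¹ * MeanField.vonNeumannEntropy (MeanField.densityMatrix ρ.1)) F := by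
  open MeanField in
  have : NeZero k := ⟨by omega⟩
  have hβ' : 0 < β⁻¹ := inv_pos.mpr hβ
  obtain ⟨h₀, hlim, hclose⟩ := exists_meanFieldLimit hH hHerm
  refine ⟨h₀, fun ω => ?_, fun N hN => isGLB_localFreeEnergy hβ
    (isHermitian_natCast_smul (hHerm N hN)), ?_⟩
  · refine ((Complex.continuous_ofReal.tendsto _).comp (hlim ω)).congr' ?_
    filter_upwards [eventually_ge_atTop 1] with N hN
    have := state_apply_eq_re (productState ω N).2 (hHerm N hN)
    rw [productState_apply] at this
    exact this.symm
  · let f : C(StateSpace (Matrix (Fin k) (Fin k) ℂ), ℝ) := h₀ - β⁻¹ • s₀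
    have hf : ∀ ρ, f ρ = h₀ ρ - β⁻¹ * vonNeumannEntropy (densityMatrix ρ.1) := fun ρ => rfl
    -- By compactness the minimum is attained; its value is the limit, and `ρ₀` supplies the trial
    -- product state for the upper bound.
    obtain ⟨ρ₀, -, hρ₀⟩ := isCompact_univ.exists_isMinOn Set.univ_nonempty f.continuous.continuousOn
    have hmin : ∀ ρ, f ρ₀ ≤ f ρ := fun ρ => hρ₀ (Set.mem_univ ρ)
    have hglb : IsGLB (Set.range fun ρ : StateSpace (Matrix (Fin k) (Fin k) ℂ) =>
        h₀ ρ - β⁻¹ * vonNeumannEntropy (densityMatrix ρ.1)) (f ρ₀) :=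
      IsLeast.isGLB ⟨⟨ρ₀, rfl⟩, by rintro _ ⟨ρ, rfl⟩; exact hmin ρ⟩
    refine ⟨f ρ₀, tendsto_order.mpr ⟨fun x hx => ?_, fun x hx => ?_⟩, ?_, ?_, hglb⟩
    · have hc : 0 < 4 + 2 * β⁻¹ := by positivity
      have hx' : 0 < f ρ₀ - x := sub_pos.mpr hx
      -- The choice of `ε` makes the total loss half of the gap `f ρ₀ - x`.
      filter_upwards [eventually_le_freeEnergy hβ hH hHerm hclose hmin
        (ε := (f ρ₀ - x) / 2 / (4 + 2 * β⁻¹)) (by positivity)] with N hN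
      rw [mul_div_cancel₀ _ hc.ne'] at hN
      linarith
    · filter_upwards [((hlim ρ₀).sub_const _).eventually_lt_const (show _ < x from hx),
        eventually_ge_atTop 1] with N h1 h2
      exact (freeEnergy_le_product hβ h2 (hHerm N h2) ρ₀).trans_lt h1
    · refine IsLeast.isGLB ⟨⟨pointState ρ₀, meanFieldFreeEnergyAt_pointState h₀ ρ₀⟩, ?_⟩
      rintro _ ⟨ω, rfl⟩
      beta_reduce
      rw [meanFieldFreeEnergyAt_eq]
      exact le_state_apply ω hmin
    · simp only [meanFieldFreeEnergyAt_pointState]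
      exact hglb
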